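/- Let $d\ge 1$, $\sigma\in\mathbb N$ (with $0$ allowed), $\epsilon\in\{1,-1\}$, $T>0$, $s>d/2$, $\alpha>0$, $\beta\ge 0$, and write $\langle\xi\rangle=(1+|\xi|^2)^{1/2}$. For $h\in(0,1]$ let $P_h:\mathbb R^d\to\mathbb R$ be measurable symbols for which there is a constant $C_0$ with $$\bigl|P_h(\xi)+|\xi|^2\bigr|\le C_0\,h^{\alpha}\langle\xi\rangle^{\beta}\qquad\text{for all }h\in(0,1],\ \xi\in\mathbb R^d,$$ and let $P_h(D)$ be the Fourier multiplier with symbol $P_h$. Let $\chi\in\mathcal S(\mathbb R^d;[0,1])$ be even and equal to $1$ on the unit ball, set $\chi_h(\xi)=\chi(h\xi)$, and let $\Pi_h$ be the Fourier multiplier with symbol $\chi_h$. Let $u_0\in L^2(\mathbb R^d)$ and let $u\in C([0,T];L^2(\mathbb R^d))$ be a solution of $$i\partial_t u+\Delta u=\epsilon|u|^{2\sigma}u,\qquad u_{|t=0}=u_0,$$ such that $u\in L^\infty([0,T];H^{s+\beta}(\mathbb R^d))$. For $h\in(0,1]$ let $u^h\in C([0,T];L^2(\mathbb R^d))$ be the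 solution of $$i\partial_t u^h+P_h(D)u^h=\epsilon\bigl(\Pi_h(|u^h|^2)\bigr)^{\sigma}u^h,\qquad u^h_{|t=0}=u_0 .$$ Solutions are understood in the sense of Duhamel's formula: a solution of $i\partial_t w+P(D)w=N(w)$, $w_{|t=0}=u_0$, is a $w\in C([0,T];L^2)$ with $N(w)\in L^1([0,T];L^2)$ and $w(t)=e^{itP(D)}u_0-i\int_0^t e^{i(t-\tau)P(D)}N(w(\tau))\,d\tau$ for all $t\in[0,T]$. Then there is a constant $C$, independent of $h$, such that for all $h\in(0,1]$ $$\|u-u^h\|_{L^\infty([0,T];H^s)}\le C\,h^{\min(\alpha,\beta)} .$$ -/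

import Mathlib

open MeasureTheory FourierTransform Set

noncomputable section

namespace SaturatedNLS

/-- The Euclidean space `ℝ^d`. -/
abbrev Space (d : ℕ) : Type := EuclideanSpace ℝ (Fin d)

/-- The Hilbert space `L²(ℝ^d; ℂ)`. -/
abbrev L2 (d : ℕ) : Type := Lp (α := Space d) ℂ 2 volume

/-- The Japanese bracket `⟨ξ⟩ = (1 + |ξ|²)^{1/2}`. -/
def japaneseBracket {d : ℕ} (ξ : Space d) : ℝ := (1 + ‖ξ‖ ^ 2) ^ ((1 : ℝ) / 2)

/-- The Sobolev norm `‖f‖_{H^s} = (∫ ⟨ξ⟩^{2s} |f̂(ξ)|² dξ)^{1/2} ∈ [0,∞]` of `f ∈ L²`, where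
`f̂(ξ) = (2π)^{-d/2} ∫ e^{-i x·ξ} f(x) dx`. Mathlib's transform is
`𝓕 f η = ∫ e^{-2π i x·η} f(x) dx`, so `f̂(ξ) = (2π)^{-d/2} 𝓕 f (ξ / 2π)`, and the substitution
`ξ = 2π η` gives exactly the expression below.
For `s ≥ 0`, `f ∈ H^s` means that this norm is finite. -/
def sobolevENorm {d : ℕ} (s : ℝ) (f : L2 d) : ENNReal :=
  (∫⁻ η : Space d, ENNReal.ofReal (japaneseBracket ((2 * Real.pi) • η) ^ (2 * s)) *
    ‖(𝓕 f : L2 d) η‖ₑ ^ 2) ^ ((1 : ℝ) / 2)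

/-- The norm of `L^∞([0,T]; H^s)`, with values in `[0,∞]`. -/
def supSobolevENorm {d : ℕ} (T s : ℝ) (u : ℝ → L2 d) : ENNReal :=
  essSup (fun t => sobolevENorm s (u t)) (volume.restrict (Icc 0 T))

/-- The Fourier multiplier `m(D)` on `L²`: `(m(D) f)^(ξ) = m(ξ) f̂(ξ)`, with `ξ = 2π η` in terms of
the variable `η` of Mathlib's transform. (The value is `0` if `m(ξ) f̂(ξ)` is not in `L²`; this
does not occur for a bounded measurable `m`.) -/
def fourierMultiplier {d : ℕ} (m : Space d → ℂ) (f : L2 d) : L2 d :=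
  open Classical in
  if hf : MemLp (fun η : Space d => m ((2 * Real.pi) • η) * (𝓕 f : L2 d) η) 2 volume then
    𝓕⁻ (hf.toLp _ : L2 d)
  else 0

/-- The unitary group `S(t) = e^{i t P(D)}` generated by `i ∂_t u + P(D) u = 0`. -/
def propagator {d : ℕ} (P : Space d → ℝ) (t : ℝ) (f : L2 d) : L2 d :=
  fourierMultiplier (fun ξ => Complex.exp (Complex.I * (t * P ξ : ℝ))) f

/-- `u` is a solution on `[0,T]`, continuous with values in `L²`, of
`i ∂_t u + P(D) u = N(u)`, `u(0) = u₀`, in the sense of Duhamel's formula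
`u(t) = S(t) u₀ - i ∫_0^t S(t - τ) N(u(τ)) dτ`. The function `F` is the map `τ ↦ N(u(τ))`, which
is required to be an integrable function of time with values in `L²`. -/
def IsSolution {d : ℕ} (P : Space d → ℝ) (N : (Space d → ℂ) → Space d → ℂ) (T : ℝ)
    (u₀ : L2 d) (u : ℝ → L2 d) : Prop :=
  ContinuousOn u (Icc 0 T) ∧
  ∃ F : ℝ → L2 d,
    IntegrableOn F (Icc 0 T) volume ∧
    (∀ᵐ τ ∂(volume.restrict (Icc (0 : ℝ) T)), (F τ : Space d → ℂ) =ᵐ[volume] N (u τ)) ∧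
    ∀ t ∈ Icc (0 : ℝ) T,
      u t = propagator P t u₀ - Complex.I • ∫ τ in (0 : ℝ)..t, propagator P (t - τ) (F τ)

/-- The power nonlinearity `ε |v|^{2σ} v`. -/
def powerNonlinearity {d : ℕ} (ε : ℝ) (σ : ℕ) (v : Space d → ℂ) (x : Space d) : ℂ :=
  (ε : ℂ) * (‖v x‖ : ℂ) ^ (2 * σ) * v x

/-- The frequency cut-off `Π g`, `(Π g)^ = χ ĝ`, of an integrable function `g` on `ℝ^d`,
as an inverse Fourier integral (again with `ξ = 2π η`). -/
def cutoff {d : ℕ} (χ : Space d → ℝ) (g : Space d → ℂ) : Space d → ℂ :=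
  𝓕⁻ (fun η : Space d => (χ ((2 * Real.pi) • η) : ℂ) * (𝓕 g) η)

/-- The saturated nonlinearity `ε (Π(|v|²))^σ v`. -/
def saturatedNonlinearity {d : ℕ} (ε : ℝ) (σ : ℕ) (χ : Space d → ℝ) (v : Space d → ℂ)
    (x : Space d) : ℂ :=
  (ε : ℂ) * (cutoff χ (fun y => ((‖v y‖ ^ 2 : ℝ) : ℂ)) x) ^ σ * v x

/-- A bounded measurable symbol defines a Fourier multiplier on all of `L²`. -/
theorem memLp_symbol_mul {d : ℕ} {m : Space d → ℂ} (hm : Measurable m) {C : ℝ}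
    (hC : ∀ ξ, ‖m ξ‖ ≤ C) (f : L2 d) :
    MemLp (fun η : Space d => m ((2 * Real.pi) • η) * (𝓕 f : L2 d) η) 2 volume := by
  have h1 : AEStronglyMeasurable (fun η : Space d => m ((2 * Real.pi) • η)) volume :=
    (hm.comp (measurable_const_smul _)).aestronglyMeasurable
  refine (Lp.memLp (𝓕 f : L2 d)).of_le_mul (c := C)
    (h1.mul (Lp.memLp (𝓕 f : L2 d)).1) (Filter.Eventually.of_forall fun η => ?_)
  rw [norm_mul]
  exact mul_le_mul_of_nonneg_right (hC _) (norm_nonneg _)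

/-- On the Fourier side, `S(t)` is the multiplication by `e^{i t P}`. -/
theorem fourier_propagator {d : ℕ} {P : Space d → ℝ} (hP : Measurable P) (t : ℝ) (f : L2 d) :
    (𝓕 (propagator P t f) : L2 d) =ᵐ[volume] fun η : Space d =>
      Complex.exp (Complex.I * (t * P ((2 * Real.pi) • η) : ℝ)) * (𝓕 f : L2 d) η := by
  have hm : Measurable fun ξ : Space d => Complex.exp (Complex.I * (t * P ξ : ℝ)) := by
    fun_prop
  have h := memLp_symbol_mul hm (C := 1) (fun ξ => by
    rw [mul_comm, Complex.norm_exp_ofReal_mul_I]) f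
  rw [propagator, fourierMultiplier, dif_pos h, FourierTransform.fourier_fourierInv_eq]
  exact h.coeFn_toLp

end SaturatedNLS

end

/-! Subtract the two Duhamel formulas. The difference of the groups e^{itΔ} and e^{itP_h} costs a
factor T C₀ h^α and β derivatives, and it can be made to act only on u₀ and on the nonlinearity of
u, both in H^{s+β}. In the nonlinear difference, |u|² - Π_h|v|² = (1 - Π_h)|u|² + Π_h(|u|² - |v|²).
The first term is O(h^β) in H^s, since 1 - χ(hξ) ≤ h^β⟨ξ⟩^β; the second is Lipschitz in u - v, since
H^s is an algebra and Π_h is a contraction there. Grönwall then gives h^{min(α,β)}, provided that v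
= u^h is bounded in H^s uniformly in h. That bound is the real content, because v is only assumed
continuous in L².

It is obtained in three layers. For a fixed h, the symbol χ_h is integrable against every weight
⟨ξ⟩^s and |v|² has a Fourier transform bounded by the mass, which is conserved because Π_h|v|² is
real. So v solves an equation with a potential smooth in terms of ‖u₀‖ alone, and stays in H^s
(`wNorm_saturated_le`). The bound is uniform for h ≥ h₀ but not as h → 0. For small h, take d/2 < r
< s and compare u with v in H^r: there γ = s + β - r > 0 derivatives are to spare even when β = 0,
the error is O(h^{min(α,γ)}), and a bootstrap keeps v within distance 1 of u (`bootstrap_ennreal`).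
Finally, the nonlinearity is tame, i.e. linear in the H^s norm once the H^r norm is bounded, so
Grönwall lifts the H^r bound to H^s uniformly (`exists_wNorm_saturated_le_of_low`).

Norms are L² norms of w f̂ with values in [0,∞]. Products are treated as convolutions through
Young's inequality and H^s ⊆ 𝓕L¹ for s > d/2. Bounded truncations of the weight supply finiteness
and continuity in time where the H^s norm itself has neither a priori. -/

noncomputable section

namespace SaturatedNLS

open Filter Topology

variable {d : ℕ}

/-! ### Fourier integrals and the Fourier transform on L². -/

theorem continuous_fourierInv_of_integrable {φ : Space d → ℂ} (hφ : Integrable φ) :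
    Continuous (𝓕⁻ φ) :=
  VectorFourier.fourierIntegral_continuous Real.continuous_fourierChar
    (by exact continuous_inner.neg) hφ

theorem continuous_fourier_of_integrable {φ : Space d → ℂ} (hφ : Integrable φ) :
    Continuous (𝓕 φ) :=
  VectorFourier.fourierIntegral_continuous Real.continuous_fourierChar
    (by exact continuous_inner) hφ

/-- Moving the transform onto a test function is what links the Fourier integral with the transform
of L², which is accessible through tempered distributions. -/
theorem integral_smul_fourier {φ : Space d → ℂ} (hφ : Integrable φ) (g : SchwartzMap (Space d) ℂ) :
    ∫ x, (𝓕 g) x • φ x = ∫ x, g x • 𝓕 φ x := by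
  have := VectorFourier.integral_fourierIntegral_smul_eq_flip (L := innerₗ (Space d))
    (μ := volume) (ν := volume) (f := g) (g := φ) Real.continuous_fourierChar
    (by exact continuous_inner) g.integrable hφ
  rw [flip_innerₗ] at this
  simpa [SchwartzMap.fourier_coe] using! this

theorem integral_smul_fourierInv {φ : Space d → ℂ} (hφ : Integrable φ)
    (g : SchwartzMap (Space d) ℂ) :
    ∫ x, (𝓕⁻ g) x • φ x = ∫ x, g x • 𝓕⁻ φ x := by
  have h := integral_smul_fourier hφ.comp_neg g
  rw [← integral_neg_eq_self] at h
  simp only [neg_neg] at h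
  rw [Real.fourierInv_eq_fourier_comp_neg, ← h]
  congr 1

/-- On `L¹ ∩ L²` the inverse Fourier transform of `L²` is the inverse Fourier integral. -/
theorem fourierInv_L2_eq_integral {φ : L2 d} (hφ : Integrable φ) :
    ((𝓕⁻ φ : L2 d) : Space d → ℂ) =ᵐ[volume] 𝓕⁻ (φ : Space d → ℂ) := by
  apply ae_eq_of_integral_contDiff_smul_eq
  · exact (Lp.memLp _).locallyIntegrable (by norm_num)
  · exact (continuous_fourierInv_of_integrable hφ).locallyIntegrable
  intro g hg hgc
  set G : SchwartzMap (Space d) ℂ := HasCompactSupport.toSchwartzMap (f := fun x => (g x : ℂ))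
    (hgc.comp_left (g := ((↑) : ℝ → ℂ)) (by simp)) (Complex.ofRealCLM.contDiff.comp hg) with hG
  -- The L² transform is compatible with that of tempered distributions; evaluated at G, the
  -- transform falls on G and is moved back onto φ as an integral.
  have h1 := congrArg (fun D => D G) (Lp.fourierInv_toTemperedDistribution_eq φ)
  simp only [TemperedDistribution.fourierInv_apply, Lp.toTemperedDistribution_apply] at h1
  rw [integral_smul_fourierInv hφ G] at h1
  have hGx : ∀ x, G x = (g x : ℂ) := fun x => rfl
  simp only [hGx] at h1
  simpa [Complex.real_smul] using h1.symm

/-- On `L¹ ∩ L²` the Fourier transform of `L²` is the Fourier integral. -/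
theorem fourier_L2_eq_integral {φ : L2 d} (hφ : Integrable φ) :
    ((𝓕 φ : L2 d) : Space d → ℂ) =ᵐ[volume] 𝓕 (φ : Space d → ℂ) := by
  apply ae_eq_of_integral_contDiff_smul_eq
  · exact (Lp.memLp _).locallyIntegrable (by norm_num)
  · exact (continuous_fourier_of_integrable hφ).locallyIntegrable
  intro g hg hgc
  set G : SchwartzMap (Space d) ℂ := HasCompactSupport.toSchwartzMap (f := fun x => (g x : ℂ))
    (hgc.comp_left (g := ((↑) : ℝ → ℂ)) (by simp)) (Complex.ofRealCLM.contDiff.comp hg) with hG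
  have h1 := congrArg (fun D => D G) (Lp.fourier_toTemperedDistribution_eq φ)
  simp only [TemperedDistribution.fourier_apply, Lp.toTemperedDistribution_apply] at h1
  rw [integral_smul_fourier hφ G] at h1
  have hGx : ∀ x, G x = (g x : ℂ) := fun x => rfl
  simp only [hGx] at h1
  simpa [Complex.real_smul] using h1.symm

theorem fourierInv_congr_ae {φ ψ : Space d → ℂ} (h : φ =ᵐ[volume] ψ) : 𝓕⁻ φ = 𝓕⁻ ψ := by
  ext x
  rw [Real.fourierInv_eq, Real.fourierInv_eq]
  exact integral_congr_ae (h.mono fun y hy => by simp only [hy])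

theorem fourier_congr_ae {φ ψ : Space d → ℂ} (h : φ =ᵐ[volume] ψ) : 𝓕 φ = 𝓕 ψ := by
  ext x
  rw [Real.fourier_eq, Real.fourier_eq]
  exact integral_congr_ae (h.mono fun y hy => by simp only [hy])

/-- An `L²` function with integrable Fourier transform is given by the inversion formula. -/
theorem coeFn_eq_fourierInv {f : L2 d} (hf : Integrable (𝓕 f : L2 d)) :
    (f : Space d → ℂ) =ᵐ[volume] 𝓕⁻ ((𝓕 f : L2 d) : Space d → ℂ) := by
  have := fourierInv_L2_eq_integral hf
  rwa [FourierTransform.fourierInv_fourier_eq] at this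

/-- An `L²` function which is an inverse Fourier integral. -/
theorem fourier_ae_eq_of_eq_fourierInv {f : L2 d} {φ : Space d → ℂ} (hφ : Integrable φ)
    (hφ2 : MemLp φ 2 volume) (hf : (f : Space d → ℂ) =ᵐ[volume] 𝓕⁻ φ) :
    (𝓕 f : L2 d) =ᵐ[volume] φ := by
  have h1 : ((𝓕⁻ (hφ2.toLp φ) : L2 d) : Space d → ℂ) =ᵐ[volume] 𝓕⁻ φ := by
    have := fourierInv_L2_eq_integral (φ := hφ2.toLp φ) (hφ.congr hφ2.coeFn_toLp.symm)
    rwa [fourierInv_congr_ae hφ2.coeFn_toLp] at this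
  have h2 : f = 𝓕⁻ (hφ2.toLp φ) := Lp.ext (hf.trans h1.symm)
  rw [h2, FourierTransform.fourier_fourierInv_eq]
  exact hφ2.coeFn_toLp

theorem enorm_fourierInv_le (φ : Space d → ℂ) (x : Space d) : ‖𝓕⁻ φ x‖ₑ ≤ ∫⁻ y, ‖φ y‖ₑ := by
  rw [Real.fourierInv_eq]
  refine (enorm_integral_le_lintegral_enorm _).trans (le_of_eq ?_)
  congr 1; ext y
  rw [Circle.smul_def, enorm_smul, ← ofReal_norm, Circle.norm_coe]
  simp

theorem enorm_fourier_le (φ : Space d → ℂ) (x : Space d) : ‖𝓕 φ x‖ₑ ≤ ∫⁻ y, ‖φ y‖ₑ := by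
  rw [Real.fourier_eq]
  refine (enorm_integral_le_lintegral_enorm _).trans (le_of_eq ?_)
  congr 1; ext y
  rw [Circle.smul_def, enorm_smul, ← ofReal_norm, Circle.norm_coe]
  simp

theorem fourierInv_conj (φ : Space d → ℂ) (x : Space d) :
    𝓕⁻ (fun η => (starRingEnd ℂ) (φ (-η))) x = (starRingEnd ℂ) (𝓕⁻ φ x) := by
  rw [Real.fourierInv_eq, Real.fourierInv_eq, ← integral_conj, ← integral_neg_eq_self]
  congr 1; ext y
  simp [Circle.smul_def, Real.fourierChar_apply, ← Complex.exp_conj, inner_neg_left,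
    map_ofNat (starRingEnd ℂ) 2]

theorem fourier_conj (φ : Space d → ℂ) (x : Space d) :
    𝓕 (fun η => (starRingEnd ℂ) (φ η)) x = (starRingEnd ℂ) (𝓕 φ (-x)) := by
  rw [Real.fourier_eq, Real.fourier_eq, ← integral_conj]
  congr 1; ext y
  simp [Circle.smul_def, Real.fourierChar_apply, ← Complex.exp_conj, inner_neg_right,
    map_ofNat (starRingEnd ℂ) 2]

open Convolution in
theorem fourierInv_convolution {φ ψ : Space d → ℂ} (hφ : Integrable φ) (hψ : Integrable ψ)
    (x : Space d) :
    𝓕⁻ (φ ⋆[ContinuousLinearMap.mul ℂ ℂ] ψ) x = 𝓕⁻ φ x * 𝓕⁻ ψ x := by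
  simp only [Real.fourierInv_eq_fourier_neg]
  exact Real.fourier_mul_convolution_eq hφ hψ (-x)

/-! ### L² norms of functions with values in [0,∞], and Young's inequality. -/

theorem eLpNorm_two_eq {a : Space d → ENNReal} :
    eLpNorm a 2 volume = (∫⁻ x, a x ^ 2) ^ ((1 : ℝ) / 2) := by
  rw [eLpNorm_eq_lintegral_rpow_enorm_toReal (by norm_num) (by norm_num)]
  simp

theorem eLpNorm_two_sq {a : Space d → ENNReal} :
    eLpNorm a 2 volume ^ 2 = ∫⁻ x, a x ^ 2 := by
  rw [eLpNorm_two_eq, ← ENNReal.rpow_natCast, ← ENNReal.rpow_mul]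
  simp

/-- Dominated convergence in `L²`. -/
theorem tendsto_eLpNorm_two_zero {ι : Type*} {l : Filter ι} [l.IsCountablyGenerated]
    {F : ι → Space d → ENNReal} {b : Space d → ENNReal} (hF : ∀ i, Measurable (F i))
    (hb : eLpNorm b 2 volume ≠ ⊤) (hFb : ∀ i, ∀ᵐ x, F i x ≤ b x)
    (hlim : ∀ᵐ x, Tendsto (fun i => F i x) l (𝓝 0)) :
    Tendsto (fun i => eLpNorm (F i) 2 volume) l (𝓝 0) := by
  have h := tendsto_lintegral_filter_of_dominated_convergence (μ := volume) (l := l)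
    (F := fun i x => F i x ^ 2) (f := fun _ => 0) (fun x => b x ^ 2)
    (Eventually.of_forall fun i => (hF i).pow_const 2)
    (Eventually.of_forall fun i => (hFb i).mono fun x hx => by gcongr)
    (by rw [← eLpNorm_two_sq]; exact ENNReal.pow_ne_top hb)
    (hlim.mono fun x hx => by
      have := (ENNReal.continuous_pow 2).tendsto 0 |>.comp hx
      simpa using! this)
  simp only [eLpNorm_two_eq]
  have h2 := (ENNReal.continuous_rpow_const (y := (1 : ℝ) / 2)).tendsto 0 |>.comp
    (by simpa using h)
  simpa using! h2

/-- Young's inequality `L¹ * L² ⊆ L²` for nonnegative functions. -/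
theorem eLpNorm_two_lconvolution_le {a b : Space d → ENNReal} (ha : Measurable a)
    (hb : Measurable b) :
    eLpNorm (fun η => ∫⁻ y, a y * b (η - y)) 2 volume ≤ (∫⁻ y, a y) * eLpNorm b 2 volume := by
  -- Cauchy–Schwarz for the measure a(y) dy, by writing a = a^{1/2} · a^{1/2}.
  have key : ∀ η, (∫⁻ y, a y * b (η - y)) ^ 2 ≤ (∫⁻ y, a y) * ∫⁻ y, a y * b (η - y) ^ 2 := by
    intro η
    have h := ENNReal.lintegral_mul_le_Lp_mul_Lq volume Real.HolderConjugate.two_two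
      (f := fun y => a y ^ ((1 : ℝ) / 2)) (g := fun y => a y ^ ((1 : ℝ) / 2) * b (η - y))
      (ha.pow_const _).aemeasurable (by fun_prop)
    have e1 : ∀ y, a y ^ ((1 : ℝ) / 2) * a y ^ ((1 : ℝ) / 2) = a y := fun y => by
      rw [← ENNReal.rpow_add_of_nonneg _ _ (by norm_num) (by norm_num)]; norm_num
    have e2 : ∀ y, (a y ^ ((1 : ℝ) / 2)) ^ (2 : ℝ) = a y := fun y => by
      rw [← ENNReal.rpow_mul]; norm_num
    simp only [Pi.mul_apply, ← mul_assoc, e1, e2, ENNReal.mul_rpow_of_nonneg _ _ zero_le_two] at h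
    calc (∫⁻ y, a y * b (η - y)) ^ 2
        ≤ ((∫⁻ y, a y) ^ ((1 : ℝ) / 2) * (∫⁻ y, a y * b (η - y) ^ (2 : ℝ)) ^ ((1 : ℝ) / 2)) ^ 2 := by
          gcongr
      _ = _ := by
          rw [mul_pow, ← ENNReal.rpow_natCast, ← ENNReal.rpow_natCast, ← ENNReal.rpow_mul,
            ← ENNReal.rpow_mul]
          simp
  have hsq : eLpNorm (fun η => ∫⁻ y, a y * b (η - y)) 2 volume ^ 2
      ≤ ((∫⁻ y, a y) * eLpNorm b 2 volume) ^ 2 := by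
    rw [eLpNorm_two_sq, mul_pow, eLpNorm_two_sq]
    calc ∫⁻ η, (∫⁻ y, a y * b (η - y)) ^ 2
        ≤ ∫⁻ η, (∫⁻ y, a y) * ∫⁻ y, a y * b (η - y) ^ 2 := lintegral_mono key
      _ = (∫⁻ y, a y) * ∫⁻ η, ∫⁻ y, a y * b (η - y) ^ 2 := by
          rw [lintegral_const_mul]
          have : Measurable fun p : Space d × Space d => a p.2 * b (p.1 - p.2) ^ 2 := by fun_prop
          exact this.lintegral_prod_right'
      _ = (∫⁻ y, a y) * ∫⁻ y, ∫⁻ η, a y * b (η - y) ^ 2 := by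
          rw [lintegral_lintegral_swap]
          exact Measurable.aemeasurable (by fun_prop)
      _ = (∫⁻ y, a y) * ∫⁻ y, a y * ∫⁻ η, b η ^ 2 := by
          congr 2; ext y
          rw [lintegral_const_mul _ (by fun_prop)]
          congr 1
          exact lintegral_sub_right_eq_self (fun η => b η ^ 2) y
      _ = _ := by rw [lintegral_mul_const _ ha]; ring
  exact (ENNReal.pow_le_pow_left_iff two_ne_zero).1 hsq

theorem eLpNorm_two_coeFn (f : L2 d) : eLpNorm (fun η => ‖f η‖ₑ) 2 volume = ‖f‖ₑ := by
  rw [eLpNorm_enorm, Lp.enorm_def]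

/-! ### Fourier transform of a product. -/

open Convolution in
theorem measurable_mul_convolution {φ ψ : Space d → ℂ} (hφ : StronglyMeasurable φ)
    (hψ : StronglyMeasurable ψ) :
    StronglyMeasurable (φ ⋆[ContinuousLinearMap.mul ℂ ℂ] ψ) := by
  have : StronglyMeasurable fun p : Space d × Space d => φ p.2 * ψ (p.1 - p.2) :=
    (hφ.comp_measurable measurable_snd).mul (hψ.comp_measurable (measurable_fst.sub measurable_snd))
  exact this.integral_prod_right

open Convolution in
theorem enorm_convolution_le (φ ψ : Space d → ℂ) (η : Space d) :
    ‖(φ ⋆[ContinuousLinearMap.mul ℂ ℂ] ψ) η‖ₑ ≤ ∫⁻ y, ‖φ y‖ₑ * ‖ψ (η - y)‖ₑ := by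
  refine (enorm_integral_le_lintegral_enorm _).trans (le_of_eq ?_)
  simp

open Convolution in
/-- The Fourier transform of a product is the convolution, for nice factors. -/
theorem fourier_mul_ae_eq_convolution {φ : Space d → ℂ} (hφm : StronglyMeasurable φ)
    (hφ : Integrable φ) {g G : L2 d} (hg : Integrable (𝓕 g : L2 d))
    (hG : (G : Space d → ℂ) =ᵐ[volume] fun x => 𝓕⁻ φ x * g x) :
    (𝓕 G : L2 d) =ᵐ[volume] φ ⋆[ContinuousLinearMap.mul ℂ ℂ] ((𝓕 g : L2 d) : Space d → ℂ) := by
  have hm : StronglyMeasurable ((𝓕 g : L2 d) : Space d → ℂ) := Lp.stronglyMeasurable _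
  refine fourier_ae_eq_of_eq_fourierInv (hφ.integrable_convolution _ hg) ⟨?_, ?_⟩ ?_
  · exact (measurable_mul_convolution hφm hm).aestronglyMeasurable
  · have h1 : eLpNorm (φ ⋆[ContinuousLinearMap.mul ℂ ℂ] ((𝓕 g : L2 d) : Space d → ℂ)) 2 volume
        ≤ eLpNorm (fun η => ∫⁻ y, ‖φ y‖ₑ * ‖(𝓕 g : L2 d) (η - y)‖ₑ) 2 volume :=
      eLpNorm_mono_enorm fun η => by simpa using enorm_convolution_le _ _ η
    refine h1.trans_lt ((eLpNorm_two_lconvolution_le hφm.measurable.enorm hm.measurable.enorm).trans_lt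
      (ENNReal.mul_lt_top hφ.2 ?_))
    rw [eLpNorm_two_coeFn]
    exact enorm_lt_top
  · filter_upwards [hG, coeFn_eq_fourierInv hg] with x h1 h2
    rw [h1, fourierInv_convolution hφ hg, ← h2]

theorem fourier_L2_sub (f g : L2 d) : (𝓕 (f - g) : L2 d) = 𝓕 f - 𝓕 g :=
  (Lp.fourierTransformₗᵢ (Space d) ℂ).map_sub f g

/-- Pointwise bound for the Fourier transform of a product. -/
theorem enorm_fourier_mul_le {φ : Space d → ℂ} (hφm : StronglyMeasurable φ)
    (hφ : Integrable φ) {g G : L2 d}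
    (hG : (G : Space d → ℂ) =ᵐ[volume] fun x => 𝓕⁻ φ x * g x) :
    ∀ᵐ η, ‖(𝓕 G : L2 d) η‖ₑ ≤ ∫⁻ y, ‖φ y‖ₑ * ‖(𝓕 g : L2 d) (η - y)‖ₑ := by
  have hm : StronglyMeasurable ((𝓕 g : L2 d) : Space d → ℂ) := Lp.stronglyMeasurable _
  -- For general g in L² the transform need not be integrable. Restricting it to balls makes it so;
  -- the approximations converge in L², and a subsequence of the transforms of the products
  -- converges almost everywhere, which preserves the pointwise bound.
  set B : ℕ → Set (Space d) := fun n => Metric.ball 0 n with hB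
  have hBm : ∀ n, MeasurableSet (B n) := fun n => measurableSet_ball
  have hψ2 : ∀ n, MemLp ((B n).indicator (𝓕 g : L2 d)) 2 volume := fun n =>
    (Lp.memLp _).indicator (hBm n)
  have hψ1 : ∀ n, Integrable ((B n).indicator ((𝓕 g : L2 d) : Space d → ℂ)) := fun n => by
    rw [integrable_indicator_iff (hBm n)]
    have : IsFiniteMeasure (volume.restrict (B n)) := ⟨by simpa [hB] using measure_ball_lt_top⟩
    exact ((Lp.memLp (𝓕 g : L2 d)).restrict (B n)).integrable (by norm_num)
  set gn : ℕ → L2 d := fun n => 𝓕⁻ ((hψ2 n).toLp _ : L2 d) with hgn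
  have hFgn : ∀ n, (𝓕 (gn n) : L2 d) =ᵐ[volume] (B n).indicator (𝓕 g : L2 d) := fun n => by
    rw [hgn, FourierTransform.fourier_fourierInv_eq]; exact (hψ2 n).coeFn_toLp
  obtain ⟨K, hK⟩ : ∃ K : ℝ, ∀ x, ‖𝓕⁻ φ x‖ ≤ K := ⟨(∫⁻ y, ‖φ y‖ₑ).toReal, fun x => by
    rw [← toReal_enorm]
    exact ENNReal.toReal_mono hφ.2.ne (enorm_fourierInv_le φ x)⟩
  have hmul : ∀ f : L2 d, MemLp (fun x => 𝓕⁻ φ x * f x) 2 volume := fun f =>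
    (Lp.memLp f).of_le_mul (c := K) ((continuous_fourierInv_of_integrable hφ).aestronglyMeasurable.mul
      (Lp.memLp f).1) (Eventually.of_forall fun x => by
        rw [norm_mul]; exact mul_le_mul_of_nonneg_right (hK x) (norm_nonneg _))
  have hgt : Tendsto gn atTop (𝓝 g) := by
    rw [tendsto_iff_edist_tendsto_0]
    have h1 : ∀ n, edist (gn n) g = eLpNorm (fun η => ‖(B n)ᶜ.indicator (𝓕 g : L2 d) η‖ₑ) 2 volume := by
      intro n
      rw [edist_eq_enorm_sub, ← ofReal_norm, ← Lp.norm_fourier_eq, ofReal_norm, eLpNorm_enorm,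
        Lp.enorm_def, fourier_L2_sub, ← eLpNorm_neg]
      apply eLpNorm_congr_ae
      filter_upwards [hFgn n, Lp.coeFn_sub (𝓕 (gn n) : L2 d) (𝓕 g : L2 d)] with η e1 e2
      rw [Pi.neg_apply, e2, Pi.sub_apply, e1, indicator_compl]
      simp
    simp only [h1]
    refine tendsto_eLpNorm_two_zero (b := fun η => ‖(𝓕 g : L2 d) η‖ₑ) (fun n => ?_) ?_ ?_ ?_
    · exact (hm.measurable.indicator (hBm n).compl).enorm
    · rw [eLpNorm_two_coeFn]; exact enorm_ne_top
    · exact fun n => Eventually.of_forall fun η => by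
        simpa using enorm_indicator_le_enorm_self _ _
    · refine Eventually.of_forall fun η => tendsto_const_nhds.congr' ?_
      obtain ⟨N, hN⟩ := exists_nat_gt ‖η‖
      filter_upwards [eventually_ge_atTop N] with n hn
      have : η ∈ B n := by
        simp only [hB, Metric.mem_ball, dist_zero_right]
        exact hN.trans_le (by exact_mod_cast hn)
      simp [this]
  set Gn : ℕ → L2 d := fun n => (hmul (gn n)).toLp _ with hGn
  have hGt : Tendsto Gn atTop (𝓝 G) := by
    rw [tendsto_iff_dist_tendsto_zero] at hgt ⊢
    refine squeeze_zero (fun _ => dist_nonneg) (fun n => ?_) (by simpa using hgt.const_mul K)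
    rw [dist_eq_norm, dist_eq_norm]
    refine Lp.norm_le_mul_norm_of_ae_le_mul ?_
    filter_upwards [(hmul (gn n)).coeFn_toLp, Lp.coeFn_sub (Gn n) G, Lp.coeFn_sub (gn n) g, hG]
      with x e1 e2 e3 e4
    rw [e2, e3, Pi.sub_apply, Pi.sub_apply, e1, e4, ← mul_sub, norm_mul]
    exact mul_le_mul_of_nonneg_right (hK x) (norm_nonneg _)
  have hFGt : Tendsto (fun n => (𝓕 (Gn n) : L2 d)) atTop (𝓝 (𝓕 G)) :=
    ((Lp.fourierTransformₗᵢ (Space d) ℂ).continuous.tendsto G).comp hGt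
  obtain ⟨ns, -, hns⟩ := (tendstoInMeasure_of_tendsto_Lp hFGt).exists_seq_tendsto_ae
  have hbd : ∀ n, ∀ᵐ η, ‖(𝓕 (Gn n) : L2 d) η‖ₑ ≤ ∫⁻ y, ‖φ y‖ₑ * ‖(𝓕 g : L2 d) (η - y)‖ₑ := by
    intro n
    have e := fourier_mul_ae_eq_convolution hφm hφ (g := gn n) ((hψ1 n).congr (hFgn n).symm)
      (hmul (gn n)).coeFn_toLp
    have e' := convolution_congr (ContinuousLinearMap.mul ℂ ℂ) (μ := volume) (Filter.EventuallyEq.refl _ φ) (hFgn n)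
    filter_upwards [e] with η h1
    rw [h1, e']
    refine (enorm_convolution_le _ _ η).trans (lintegral_mono fun y => ?_)
    gcongr
    exact enorm_indicator_le_enorm_self _ _
  filter_upwards [hns, ae_all_iff.2 hbd] with η h1 h2
  exact le_of_tendsto' h1.enorm fun i => h2 (ns i)

/-! ### The Japanese bracket, Sobolev weights and their truncations. -/

theorem one_le_japaneseBracket (ξ : Space d) : 1 ≤ japaneseBracket ξ := by
  unfold japaneseBracket
  exact Real.one_le_rpow (by nlinarith [sq_nonneg ‖ξ‖]) (by norm_num)

theorem japaneseBracket_pos (ξ : Space d) : 0 < japaneseBracket ξ :=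
  zero_lt_one.trans_le (one_le_japaneseBracket ξ)

theorem japaneseBracket_eq_sqrt (ξ : Space d) : japaneseBracket ξ = √(1 + ‖ξ‖ ^ 2) := by
  rw [japaneseBracket, Real.sqrt_eq_rpow]

theorem japaneseBracket_sq (ξ : Space d) : japaneseBracket ξ ^ 2 = 1 + ‖ξ‖ ^ 2 := by
  rw [japaneseBracket_eq_sqrt, Real.sq_sqrt (by positivity)]

theorem norm_le_japaneseBracket (ξ : Space d) : ‖ξ‖ ≤ japaneseBracket ξ := by
  have := japaneseBracket_sq ξ
  exact le_of_sq_le_sq (by nlinarith) (japaneseBracket_pos ξ).le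

theorem japaneseBracket_neg (ξ : Space d) : japaneseBracket (-ξ) = japaneseBracket ξ := by
  simp [japaneseBracket]

theorem continuous_japaneseBracket : Continuous (japaneseBracket : Space d → ℝ) := by
  have : (japaneseBracket : Space d → ℝ) = fun ξ => √(1 + ‖ξ‖ ^ 2) :=
    funext japaneseBracket_eq_sqrt
  rw [this]; fun_prop

theorem japaneseBracket_add_le (x y : Space d) :
    japaneseBracket (x + y) ≤ japaneseBracket x + japaneseBracket y := by
  have hx := japaneseBracket_sq x
  have hy := japaneseBracket_sq y
  have hxy := japaneseBracket_sq (x + y)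
  have h1 := norm_le_japaneseBracket x
  have h2 := norm_le_japaneseBracket y
  have h3 := norm_add_le x y
  have h4 : ‖x + y‖ ^ 2 ≤ (‖x‖ + ‖y‖) ^ 2 := by gcongr
  have h5 : ‖x‖ * ‖y‖ ≤ japaneseBracket x * japaneseBracket y :=
    mul_le_mul h1 h2 (norm_nonneg _) (japaneseBracket_pos x).le
  have := japaneseBracket_pos x
  have := japaneseBracket_pos y
  exact le_of_sq_le_sq (by nlinarith) (by positivity)

/-- The Sobolev weight `⟨ξ⟩^s` in the variable `η = ξ / 2π`. -/
def weight (s : ℝ) (η : Space d) : ENNReal :=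
  ENNReal.ofReal (japaneseBracket ((2 * Real.pi) • η) ^ s)

theorem continuous_weight (s : ℝ) : Continuous (weight s : Space d → ENNReal) := by
  unfold weight
  refine ENNReal.continuous_ofReal.comp ?_
  exact (continuous_japaneseBracket.comp (continuous_const_smul _)).rpow_const
    fun η => Or.inl (japaneseBracket_pos _).ne'

@[fun_prop]
theorem measurable_weight (s : ℝ) : Measurable (weight s : Space d → ENNReal) :=
  (continuous_weight s).measurable

theorem weight_neg (s : ℝ) (η : Space d) : weight s (-η) = weight s η := by
  rw [weight, weight, smul_neg, japaneseBracket_neg]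

theorem weight_mono {s t : ℝ} (h : s ≤ t) (η : Space d) : weight s η ≤ weight t η :=
  ENNReal.ofReal_le_ofReal (Real.rpow_le_rpow_of_exponent_le (one_le_japaneseBracket _) h)

theorem weight_zero (η : Space d) : weight 0 η = 1 := by simp [weight]

theorem one_le_weight {s : ℝ} (hs : 0 ≤ s) (η : Space d) : 1 ≤ weight s η := by
  rw [← weight_zero η]; exact weight_mono hs η

theorem weight_ne_top (s : ℝ) (η : Space d) : weight s η ≠ ⊤ := ENNReal.ofReal_ne_top

theorem weight_add_exponent (s t : ℝ) (η : Space d) :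
    weight (s + t) η = weight s η * weight t η := by
  rw [weight, weight, weight, ← ENNReal.ofReal_mul (by have := japaneseBracket_pos ((2 * Real.pi) • η); positivity),
    Real.rpow_add (japaneseBracket_pos _)]

theorem weight_neg_exponent (s : ℝ) (η : Space d) : weight (-s) η * weight s η = 1 := by
  rw [← weight_add_exponent, neg_add_cancel, weight_zero]

theorem weight_add_le {s : ℝ} (hs : 0 ≤ s) (x y : Space d) :
    weight s (x + y) ≤ ENNReal.ofReal (2 ^ s) * (weight s x + weight s y) := by
  unfold weight
  set a := japaneseBracket ((2 * Real.pi) • x) with ha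
  set b := japaneseBracket ((2 * Real.pi) • y) with hb
  have ha0 : 0 < a := japaneseBracket_pos _
  have hb0 : 0 < b := japaneseBracket_pos _
  rw [← ENNReal.ofReal_add (by positivity) (by positivity), ← ENNReal.ofReal_mul (by positivity)]
  apply ENNReal.ofReal_le_ofReal
  have h1 : japaneseBracket ((2 * Real.pi) • (x + y)) ≤ 2 * max a b := by
    rw [smul_add]
    refine (japaneseBracket_add_le _ _).trans ?_
    have := le_max_left a b
    have := le_max_right a b
    linarith
  calc japaneseBracket ((2 * Real.pi) • (x + y)) ^ s ≤ (2 * max a b) ^ s :=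
        Real.rpow_le_rpow (japaneseBracket_pos _).le h1 hs
    _ = 2 ^ s * (max a b) ^ s := Real.mul_rpow (by norm_num) (by positivity)
    _ ≤ 2 ^ s * (a ^ s + b ^ s) := by
        gcongr
        rcases max_choice a b with h | h <;> rw [h] <;>
          nlinarith [Real.rpow_pos_of_pos ha0 s, Real.rpow_pos_of_pos hb0 s]

/-- Submultiplicative form, used when one factor has a Fourier transform in a weighted L¹ space and
the weight of the other is to be kept. -/
theorem weight_add_le_mul {s : ℝ} (hs : 0 ≤ s) (x y : Space d) :
    weight s (x + y) ≤ ENNReal.ofReal (2 ^ (s + 1)) * weight s x * weight s y := by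
  refine (weight_add_le hs x y).trans ?_
  have hx := one_le_weight hs x
  have hy := one_le_weight hs y
  have h : weight s x + weight s y ≤ 2 * (weight s x * weight s y) := by
    rw [two_mul]
    gcongr
    · exact le_mul_of_one_le_right' hy
    · exact le_mul_of_one_le_left' hx
  calc _ ≤ ENNReal.ofReal (2 ^ s) * (2 * (weight s x * weight s y)) := by gcongr
    _ = _ := by
      rw [Real.rpow_add (by norm_num), Real.rpow_one, ENNReal.ofReal_mul (by positivity)]
      simp; ring

/-- The bounded weight `min(⟨ξ⟩^s, n)`. -/
def truncWeight (s : ℝ) (n : ℕ) (η : Space d) : ENNReal := min (weight s η) n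

@[fun_prop]
theorem measurable_truncWeight (s : ℝ) (n : ℕ) :
    Measurable (truncWeight s n : Space d → ENNReal) := by
  unfold truncWeight; fun_prop

theorem truncWeight_le (s : ℝ) (n : ℕ) (η : Space d) : truncWeight s n η ≤ n := min_le_right _ _

theorem truncWeight_le_weight (s : ℝ) (n : ℕ) (η : Space d) : truncWeight s n η ≤ weight s η :=
  min_le_left _ _

/-- The factor in front is at least 1, so it may also multiply the cap n. It does not depend on n,
so estimates in truncated weights are uniform in n. -/
theorem truncWeight_add_le {s : ℝ} (hs : 0 ≤ s) (n : ℕ) (x y : Space d) :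
    truncWeight s n (x + y) ≤ ENNReal.ofReal (2 ^ (s + 1)) * weight s x * truncWeight s n y := by
  have h1 : 1 ≤ ENNReal.ofReal (2 ^ (s + 1)) * weight s x :=
    one_le_mul (by
      rw [ENNReal.one_le_ofReal]; exact Real.one_le_rpow (by norm_num) (by linarith))
      (one_le_weight hs x)
  unfold truncWeight
  rw [mul_min]
  exact min_le_min (weight_add_le_mul hs x y) (le_mul_of_one_le_left' h1)

theorem eLpNorm_weight_neg_ne_top {s : ℝ} (hs : (d : ℝ) / 2 < s) :
    eLpNorm (weight (-s) : Space d → ENNReal) 2 volume ≠ ⊤ := by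
  have h : eLpNorm (weight (-s) : Space d → ENNReal) 2 volume ^ 2 ≠ ⊤ := by
    rw [eLpNorm_two_sq]
    have hint : Integrable (fun x : Space d => ((1 : ℝ) + ‖x‖ ^ 2) ^ (-(2 * s) / 2)) := by
      apply integrable_rpow_neg_one_add_norm_sq
      simp; linarith
    have hint2 := hint.comp_smul (R := 2 * Real.pi) (by positivity)
    have := hint2.2.ne
    convert this using 2
    ext η
    rw [weight, ← ENNReal.ofReal_pow (by have := japaneseBracket_pos ((2 * Real.pi) • η); positivity),
      Real.enorm_eq_ofReal (by positivity)]
    congr 1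
    rw [japaneseBracket, ← Real.rpow_mul (by positivity), ← Real.rpow_natCast, ← Real.rpow_mul (by positivity)]
    congr 1; push_cast; ring
  intro h'
  exact h (by rw [h']; rfl)

/-! ### Weighted norms on the Fourier side. -/

/-- The `L²` norm of `w f̂`. -/
def wNorm (w : Space d → ENNReal) (f : L2 d) : ENNReal :=
  eLpNorm (fun η => w η * ‖(𝓕 f : L2 d) η‖ₑ) 2 volume

theorem sobolevENorm_eq_wNorm (s : ℝ) (f : L2 d) : sobolevENorm s f = wNorm (weight s) f := by
  rw [wNorm, eLpNorm_two_eq, sobolevENorm]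
  congr 2; ext η
  rw [mul_pow, weight, ← ENNReal.ofReal_pow (by have := japaneseBracket_pos ((2 * Real.pi) • η); positivity)]
  congr 2
  rw [← Real.rpow_natCast, ← Real.rpow_mul (japaneseBracket_pos _).le]
  congr 1; push_cast; ring

theorem measurable_enorm_fourier (f : L2 d) : Measurable fun η => ‖(𝓕 f : L2 d) η‖ₑ :=
  (Lp.stronglyMeasurable (𝓕 f : L2 d)).measurable.enorm

/-- Comparison of weighted norms from a pointwise comparison. -/
theorem wNorm_le_of_ae_le {w w' : Space d → ENNReal} {f g : L2 d} (c : ENNReal) (hw' : Measurable w')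
    (h : ∀ᵐ η, w η * ‖(𝓕 f : L2 d) η‖ₑ ≤ c * (w' η * ‖(𝓕 g : L2 d) η‖ₑ)) :
    wNorm w f ≤ c * wNorm w' g := by
  unfold wNorm
  exact eLpNorm_le_mul_eLpNorm_of_ae_le_mul'' 2
    (hw'.mul (measurable_enorm_fourier g)).aestronglyMeasurable (by simpa using h)

theorem wNorm_mono {w w' : Space d → ENNReal} (h : ∀ η, w η ≤ w' η) (f : L2 d) :
    wNorm w f ≤ wNorm w' f :=
  eLpNorm_mono_enorm fun η => by simpa using mul_le_mul_left (h η) _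

theorem wNorm_one (f : L2 d) : wNorm 1 f = ‖f‖ₑ := by
  simp only [wNorm, Pi.one_apply, one_mul]
  rw [eLpNorm_two_coeFn, ← ofReal_norm, Lp.norm_fourier_eq, ofReal_norm]

theorem wNorm_add_le {w : Space d → ENNReal} (hw : Measurable w) (f g : L2 d) :
    wNorm w (f + g) ≤ wNorm w f + wNorm w g := by
  unfold wNorm
  refine le_trans ?_ (eLpNorm_add_le (hw.mul (measurable_enorm_fourier f)).aestronglyMeasurable
    (hw.mul (measurable_enorm_fourier g)).aestronglyMeasurable (by norm_num))
  apply eLpNorm_mono_enorm_ae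
  rw [FourierTransform.fourier_add]
  filter_upwards [Lp.coeFn_add (𝓕 f : L2 d) (𝓕 g)] with η h
  rw [h]
  simp only [Pi.add_apply, enorm_eq_self, ← mul_add]
  gcongr
  exact enorm_add_le _ _

theorem wNorm_smul (w : Space d → ENNReal) (c : ℂ) (hc : ‖c‖ₑ = 1) (f : L2 d) :
    wNorm w (c • f) = wNorm w f := by
  unfold wNorm
  apply eLpNorm_congr_ae
  rw [FourierTransform.fourier_smul]
  filter_upwards [Lp.coeFn_smul c (𝓕 f : L2 d)] with η h
  rw [h, Pi.smul_apply, enorm_smul, hc, one_mul]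

theorem wNorm_neg (w : Space d → ENNReal) (f : L2 d) : wNorm w (-f) = wNorm w f := by
  have := wNorm_smul w (-1) (by simp) f
  simpa using this

theorem wNorm_sub_le {w : Space d → ENNReal} (hw : Measurable w) (f g : L2 d) :
    wNorm w (f - g) ≤ wNorm w f + wNorm w g := by
  rw [sub_eq_add_neg, ← wNorm_neg w g]
  exact wNorm_add_le hw f (-g)

theorem wNorm_truncWeight_le (s : ℝ) (n : ℕ) (f : L2 d) :
    wNorm (truncWeight s n) f ≤ n * ‖f‖ₑ := by
  rw [← wNorm_one]
  refine wNorm_le_of_ae_le _ measurable_one (Eventually.of_forall fun η => ?_)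
  rw [Pi.one_apply, one_mul]
  gcongr
  exact truncWeight_le s n η

/-- A bounded weight defines a bounded operator on `L²`. -/
theorem exists_clm_enorm_eq_wNorm {w : Space d → ENNReal} (hw : Measurable w) {n : ℕ}
    (hn : ∀ η, w η ≤ n) : ∃ A : L2 d →L[ℂ] L2 d, ∀ f, ‖A f‖ₑ = wNorm w f := by
  set m : Space d → ℂ := fun η => ((w η).toReal : ℂ) with hm
  have hmm : Measurable m := by fun_prop
  have hwt : ∀ η, w η ≠ ⊤ := fun η => ((hn η).trans_lt (by simp)).ne
  have hmn : ∀ η, ‖m η‖ₑ = w η := fun η => by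
    rw [hm, ← ofReal_norm]; simp [ENNReal.ofReal_toReal (hwt η)]
  have hb : ∀ η, ‖m η‖ ≤ n := fun η => by
    have := hn η
    rw [← hmn η, ← ofReal_norm, ENNReal.ofReal_le_natCast] at this
    exact this
  have hL : ∀ f : L2 d, MemLp (fun η => m η * f η) 2 volume := fun f =>
    (Lp.memLp f).of_le_mul (c := n) (hmm.aestronglyMeasurable.mul (Lp.memLp f).1)
      (Eventually.of_forall fun η => by
        rw [norm_mul]; exact mul_le_mul_of_nonneg_right (hb η) (norm_nonneg _))
  let A₀ : L2 d →ₗ[ℂ] L2 d :=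
    { toFun := fun f => (hL f).toLp _
      map_add' := fun f g => by
        apply Lp.ext
        filter_upwards [(hL (f + g)).coeFn_toLp, (hL f).coeFn_toLp, (hL g).coeFn_toLp,
          Lp.coeFn_add f g, Lp.coeFn_add ((hL f).toLp _) ((hL g).toLp _)] with η h1 h2 h3 h4 h5
        rw [h1, h5, Pi.add_apply, h2, h3, h4, Pi.add_apply, mul_add]
      map_smul' := fun c f => by
        apply Lp.ext
        filter_upwards [(hL (c • f)).coeFn_toLp, (hL f).coeFn_toLp,
          Lp.coeFn_smul c f, Lp.coeFn_smul c ((hL f).toLp _)] with η h1 h2 h3 h4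
        rw [h1, RingHom.id_apply, h4, Pi.smul_apply, h2, h3, Pi.smul_apply, smul_eq_mul,
          smul_eq_mul]
        ring }
  let A : L2 d →L[ℂ] L2 d := A₀.mkContinuous n fun f => by
    refine Lp.norm_le_mul_norm_of_ae_le_mul ?_
    filter_upwards [(hL f).coeFn_toLp] with η h
    change ‖((hL f).toLp _ : L2 d) η‖ ≤ _
    rw [h, norm_mul]
    exact mul_le_mul_of_nonneg_right (hb η) (norm_nonneg _)
  refine ⟨A ∘L (Lp.fourierTransformₗᵢ (Space d) ℂ : L2 d →L[ℂ] L2 d), fun f => ?_⟩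
  change ‖((hL (𝓕 f)).toLp _ : L2 d)‖ₑ = _
  rw [Lp.enorm_def, wNorm, ← eLpNorm_enorm]
  apply eLpNorm_congr_ae
  filter_upwards [(hL (𝓕 f)).coeFn_toLp] with η h
  rw [h, enorm_mul, hmn]

/-- Monotone convergence. The truncated norms are finite and continuous on L², so bounds are proved
for them and passed to a Sobolev norm not yet known to be finite. -/
theorem wNorm_weight_eq_iSup (s : ℝ) (f : L2 d) :
    wNorm (weight s) f = ⨆ n, wNorm (truncWeight s n) f := by
  have hmono : Monotone fun (n : ℕ) (η : Space d) => (truncWeight s n η * ‖(𝓕 f : L2 d) η‖ₑ) ^ 2 := by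
    intro n m hnm η
    have : truncWeight s n η ≤ truncWeight s m η :=
      min_le_min le_rfl (by exact_mod_cast hnm)
    dsimp only
    gcongr
  have hsup : ∀ η : Space d, ⨆ n, (truncWeight s n η * ‖(𝓕 f : L2 d) η‖ₑ) ^ 2
      = (weight s η * ‖(𝓕 f : L2 d) η‖ₑ) ^ 2 := by
    intro η
    apply le_antisymm
    · refine iSup_le fun n => ?_
      gcongr
      exact truncWeight_le_weight s n η
    · obtain ⟨n, hn⟩ := exists_nat_ge ((weight s η).toReal)
      refine le_iSup_of_le n ?_
      have : truncWeight s n η = weight s η := by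
        rw [truncWeight, min_eq_left]
        rw [← ENNReal.ofReal_toReal (weight_ne_top s η)]
        exact ENNReal.ofReal_le_natCast.2 hn
      rw [this]
  simp only [wNorm, eLpNorm_two_eq]
  rw [lintegral_congr fun η => (hsup η).symm, lintegral_iSup (fun n => by
    have := measurable_enorm_fourier f
    fun_prop) hmono]
  exact (ENNReal.orderIsoRpow ((1 : ℝ) / 2) (by norm_num)).map_iSup _

/-- A truncated norm is the norm of the image under a bounded operator, which commutes with the
Bochner integral. -/
theorem wNorm_trunc_integral_le (s : ℝ) (n : ℕ) (G : ℝ → L2 d) {t : ℝ} (ht : 0 ≤ t) :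
    wNorm (truncWeight s n) (∫ τ in (0 : ℝ)..t, G τ)
      ≤ ∫⁻ τ in Ioc 0 t, wNorm (truncWeight s n) (G τ) := by
  obtain ⟨A, hA⟩ := exists_clm_enorm_eq_wNorm (measurable_truncWeight (d := d) s n) (truncWeight_le s n)
  simp only [← hA]
  rw [intervalIntegral.integral_of_le ht]
  by_cases hG : IntegrableOn G (Ioc 0 t) volume
  · rw [← A.integral_comp_comm hG]
    exact enorm_integral_le_lintegral_enorm _
  -- Without integrability the Bochner integral is 0 by convention, and the bound is trivial.
  · rw [integral_undef hG]
    simp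

theorem wNorm_integral_le (s : ℝ) (G : ℝ → L2 d) {t : ℝ} (ht : 0 ≤ t) :
    wNorm (weight s) (∫ τ in (0 : ℝ)..t, G τ) ≤ ∫⁻ τ in Ioc 0 t, wNorm (weight s) (G τ) := by
  rw [wNorm_weight_eq_iSup]
  exact iSup_le fun n => (wNorm_trunc_integral_le s n G ht).trans
    (lintegral_mono fun τ => wNorm_mono (truncWeight_le_weight s n) (G τ))

/-- The embedding `H^s ⊆ 𝓕 L¹` for `s > d/2`. -/
theorem lintegral_fourier_le (s : ℝ) (f : L2 d) :
    ∫⁻ η, ‖(𝓕 f : L2 d) η‖ₑ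
      ≤ eLpNorm (weight (-s) : Space d → ENNReal) 2 volume * wNorm (weight s) f := by
  have h := ENNReal.lintegral_mul_le_Lp_mul_Lq volume Real.HolderConjugate.two_two
    (f := (weight (-s) : Space d → ENNReal)) (g := fun η => weight s η * ‖(𝓕 f : L2 d) η‖ₑ)
    (measurable_weight _).aemeasurable
    ((measurable_weight s).mul (measurable_enorm_fourier f)).aemeasurable
  simp only [Pi.mul_apply, ← mul_assoc, weight_neg_exponent, one_mul] at h
  refine h.trans (le_of_eq ?_)
  rw [wNorm, eLpNorm_two_eq, eLpNorm_two_eq]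
  simp

theorem integrable_fourier {s : ℝ} (hs : (d : ℝ) / 2 < s) {f : L2 d}
    (hf : wNorm (weight s) f ≠ ⊤) : Integrable (𝓕 f : L2 d) :=
  ⟨(Lp.memLp _).1, (lintegral_fourier_le s f).trans_lt
    (ENNReal.mul_lt_top (eLpNorm_weight_neg_ne_top hs).lt_top hf.lt_top)⟩

/-! ### Product estimates. -/

/-- Product with a function whose Fourier transform is in a weighted `L¹` space. -/
theorem wNorm_mul_le {φ : Space d → ℂ} (hφm : StronglyMeasurable φ)
    (hφ : Integrable φ) {g G : L2 d}
    (hG : (G : Space d → ℂ) =ᵐ[volume] fun x => 𝓕⁻ φ x * g x)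
    {w κ : Space d → ENNReal} (hw : Measurable w) (hκ : Measurable κ)
    (h : ∀ x y, w (x + y) ≤ κ x * w y) :
    wNorm w G ≤ (∫⁻ y, κ y * ‖φ y‖ₑ) * wNorm w g := by
  refine le_trans ?_ (eLpNorm_two_lconvolution_le (hκ.mul hφm.measurable.enorm)
    (hw.mul (measurable_enorm_fourier g)))
  apply eLpNorm_mono_enorm_ae
  filter_upwards [enorm_fourier_mul_le hφm hφ hG] with η hη
  simp only [enorm_eq_self]
  have hm : Measurable fun y => ‖φ y‖ₑ * ‖(𝓕 g : L2 d) (η - y)‖ₑ :=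
    hφm.measurable.enorm.mul ((measurable_enorm_fourier g).comp (measurable_const_sub η))
  calc w η * ‖(𝓕 G : L2 d) η‖ₑ ≤ w η * ∫⁻ y, ‖φ y‖ₑ * ‖(𝓕 g : L2 d) (η - y)‖ₑ := by gcongr
    _ = ∫⁻ y, w η * (‖φ y‖ₑ * ‖(𝓕 g : L2 d) (η - y)‖ₑ) := by rw [lintegral_const_mul _ hm]
    _ ≤ ∫⁻ y, κ y * ‖φ y‖ₑ * (w (η - y) * ‖(𝓕 g : L2 d) (η - y)‖ₑ) := by
        refine lintegral_mono fun y => ?_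
        have h1 := h y (η - y)
        rw [add_sub_cancel] at h1
        calc _ ≤ κ y * w (η - y) * (‖φ y‖ₑ * ‖(𝓕 g : L2 d) (η - y)‖ₑ) := by gcongr
          _ = _ := by ring

/-- Tame product estimate. -/
theorem wNorm_weight_mul_le {s : ℝ} (hs : 0 ≤ s) {φ : Space d → ℂ} (hφm : StronglyMeasurable φ)
    (hφ : Integrable φ) {g G : L2 d}
    (hG : (G : Space d → ℂ) =ᵐ[volume] fun x => 𝓕⁻ φ x * g x) :
    wNorm (weight s) G ≤ ENNReal.ofReal (2 ^ s) * ((∫⁻ y, ‖φ y‖ₑ) * wNorm (weight s) g +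
      (∫⁻ y, ‖(𝓕 g : L2 d) y‖ₑ) * eLpNorm (fun η => weight s η * ‖φ η‖ₑ) 2 volume) := by
  have hgm := measurable_enorm_fourier g
  have hφe := hφm.measurable.enorm
  have hwm := measurable_weight (d := d) s
  -- `I₁` puts the weight on g and `I₂` puts it on φ. Young's inequality takes the unweighted factor
  -- in L¹ and the weighted one in L².
  set I₁ : Space d → ENNReal := fun η => ∫⁻ y, ‖φ y‖ₑ * (weight s (η - y) * ‖(𝓕 g : L2 d) (η - y)‖ₑ)
  set I₂ : Space d → ENNReal := fun η => ∫⁻ y, ‖(𝓕 g : L2 d) y‖ₑ * (weight s (η - y) * ‖φ (η - y)‖ₑ)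
  have hI₁ : Measurable I₁ := by
    have : Measurable fun p : Space d × Space d =>
        ‖φ p.2‖ₑ * (weight s (p.1 - p.2) * ‖(𝓕 g : L2 d) (p.1 - p.2)‖ₑ) :=
      (hφe.comp measurable_snd).mul ((hwm.mul hgm).comp (measurable_fst.sub measurable_snd))
    exact this.lintegral_prod_right'
  have hI₂ : Measurable I₂ := by
    have : Measurable fun p : Space d × Space d =>
        ‖(𝓕 g : L2 d) p.2‖ₑ * (weight s (p.1 - p.2) * ‖φ (p.1 - p.2)‖ₑ) :=
      (hgm.comp measurable_snd).mul ((hwm.mul hφe).comp (measurable_fst.sub measurable_snd))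
    exact this.lintegral_prod_right'
  have key : ∀ᵐ η, weight s η * ‖(𝓕 G : L2 d) η‖ₑ ≤ ENNReal.ofReal (2 ^ s) * (I₁ η + I₂ η) := by
    filter_upwards [enorm_fourier_mul_le hφm hφ hG] with η hη
    have hm : Measurable fun y => ‖φ y‖ₑ * ‖(𝓕 g : L2 d) (η - y)‖ₑ :=
      hφe.mul (hgm.comp (measurable_const_sub η))
    have e2 : I₂ η = ∫⁻ y, weight s y * ‖φ y‖ₑ * ‖(𝓕 g : L2 d) (η - y)‖ₑ := by
      rw [← lintegral_sub_left_eq_self _ η]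
      simp only [I₂, sub_sub_cancel]
      congr 1; ext y; ring
    have hm' : Measurable fun y => ‖φ y‖ₑ * (weight s (η - y) * ‖(𝓕 g : L2 d) (η - y)‖ₑ) :=
      hφe.mul ((hwm.mul hgm).comp (measurable_const_sub η))
    rw [e2, ← lintegral_add_left hm', ← lintegral_const_mul' _ _ ENNReal.ofReal_ne_top]
    calc weight s η * ‖(𝓕 G : L2 d) η‖ₑ
        ≤ weight s η * ∫⁻ y, ‖φ y‖ₑ * ‖(𝓕 g : L2 d) (η - y)‖ₑ := by gcongr
      _ = ∫⁻ y, weight s η * (‖φ y‖ₑ * ‖(𝓕 g : L2 d) (η - y)‖ₑ) := by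
        rw [lintegral_const_mul _ hm]
      _ ≤ _ := by
        refine lintegral_mono fun y => ?_
        have h1 := weight_add_le hs y (η - y)
        rw [add_sub_cancel] at h1
        calc _ ≤ ENNReal.ofReal (2 ^ s) * (weight s y + weight s (η - y)) *
              (‖φ y‖ₑ * ‖(𝓕 g : L2 d) (η - y)‖ₑ) := by gcongr
          _ = _ := by ring
  calc wNorm (weight s) G
      ≤ ENNReal.ofReal (2 ^ s) * eLpNorm (fun η => I₁ η + I₂ η) 2 volume :=
        eLpNorm_le_mul_eLpNorm_of_ae_le_mul'' 2 (hI₁.add hI₂).aestronglyMeasurable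
          (by simpa using key)
    _ ≤ ENNReal.ofReal (2 ^ s) * (eLpNorm I₁ 2 volume + eLpNorm I₂ 2 volume) := by
        gcongr
        exact eLpNorm_add_le hI₁.aestronglyMeasurable hI₂.aestronglyMeasurable (by norm_num)
    _ ≤ _ := by
        have y₁ := eLpNorm_two_lconvolution_le (b := fun η => weight s η * ‖(𝓕 g : L2 d) η‖ₑ)
          hφe (hwm.mul hgm)
        have y₂ := eLpNorm_two_lconvolution_le (b := fun η => weight s η * ‖φ η‖ₑ)
          hgm (hwm.mul hφe)
        exact mul_le_mul_right (add_le_add y₁ y₂) _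

/-! ### Sobolev bounds for pointwise products. -/

/-- The function `f` represents an element of `L²` of `H^s` norm at most `M`. -/
def HsBdd (s : ℝ) (f : Space d → ℂ) (M : ENNReal) : Prop :=
  ∃ F : L2 d, (F : Space d → ℂ) =ᵐ[volume] f ∧ wNorm (weight s) F ≤ M

theorem hsBdd_coeFn (s : ℝ) (f : L2 d) : HsBdd s f (wNorm (weight s) f) :=
  ⟨f, EventuallyEq.rfl, le_rfl⟩

theorem HsBdd.wNorm_le {s : ℝ} {f : Space d → ℂ} {M : ENNReal} (h : HsBdd s f M) {F : L2 d}
    (hF : (F : Space d → ℂ) =ᵐ[volume] f) : wNorm (weight s) F ≤ M := by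
  obtain ⟨F', h1, h2⟩ := h
  rwa [Lp.ext (hF.trans h1.symm)]

theorem HsBdd.congr {s : ℝ} {f g : Space d → ℂ} {M : ENNReal} (h : HsBdd s f M)
    (hfg : f =ᵐ[volume] g) : HsBdd s g M := by
  obtain ⟨F, h1, h2⟩ := h
  exact ⟨F, h1.trans hfg, h2⟩

theorem HsBdd.mono {s : ℝ} {f : Space d → ℂ} {M N : ENNReal} (h : HsBdd s f M) (hMN : M ≤ N) :
    HsBdd s f N := by
  obtain ⟨F, h1, h2⟩ := h
  exact ⟨F, h1, h2.trans hMN⟩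

theorem HsBdd.mono_exponent {s t : ℝ} {f : Space d → ℂ} {M : ENNReal} (h : HsBdd t f M)
    (hst : s ≤ t) : HsBdd s f M := by
  obtain ⟨F, h1, h2⟩ := h
  exact ⟨F, h1, (wNorm_mono (weight_mono hst) F).trans h2⟩

theorem HsBdd.add {s : ℝ} {f g : Space d → ℂ} {M N : ENNReal} (hf : HsBdd s f M)
    (hg : HsBdd s g N) : HsBdd s (fun x => f x + g x) (M + N) := by
  obtain ⟨F, h1, h2⟩ := hf
  obtain ⟨G, h3, h4⟩ := hg
  refine ⟨F + G, ?_, (wNorm_add_le (measurable_weight s) F G).trans (by gcongr)⟩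
  filter_upwards [Lp.coeFn_add F G, h1, h3] with x e1 e2 e3
  rw [e1, Pi.add_apply, e2, e3]

theorem HsBdd.sub {s : ℝ} {f g : Space d → ℂ} {M N : ENNReal} (hf : HsBdd s f M)
    (hg : HsBdd s g N) : HsBdd s (fun x => f x - g x) (M + N) := by
  obtain ⟨F, h1, h2⟩ := hf
  obtain ⟨G, h3, h4⟩ := hg
  refine ⟨F - G, ?_, (wNorm_sub_le (measurable_weight s) F G).trans (by gcongr)⟩
  filter_upwards [Lp.coeFn_sub F G, h1, h3] with x e1 e2 e3
  rw [e1, Pi.sub_apply, e2, e3]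

theorem HsBdd.const_mul {s : ℝ} {f : Space d → ℂ} {M : ENNReal} (hf : HsBdd s f M) {c : ℂ}
    (hc : ‖c‖ₑ = 1) : HsBdd s (fun x => c * f x) M := by
  obtain ⟨F, h1, h2⟩ := hf
  refine ⟨c • F, ?_, by rwa [wNorm_smul _ c hc]⟩
  filter_upwards [Lp.coeFn_smul c F, h1] with x e1 e2
  rw [e1, Pi.smul_apply, e2, smul_eq_mul]

theorem memLp_fourierInv_mul {φ : Space d → ℂ} (hφ : Integrable φ) (g : L2 d) :
    MemLp (fun x => 𝓕⁻ φ x * g x) 2 volume :=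
  (Lp.memLp g).of_le_mul (c := (∫⁻ y, ‖φ y‖ₑ).toReal)
    ((continuous_fourierInv_of_integrable hφ).aestronglyMeasurable.mul (Lp.memLp g).1)
    (Eventually.of_forall fun x => by
      rw [norm_mul]
      refine mul_le_mul_of_nonneg_right ?_ (norm_nonneg _)
      rw [← toReal_enorm]
      exact ENNReal.toReal_mono hφ.2.ne (enorm_fourierInv_le φ x))

/-- The constant of the product estimates in `H^s`, with low norms in `H^r`. -/
def prodConst (d : ℕ) (r s : ℝ) : ENNReal :=
  ENNReal.ofReal (2 ^ s) * eLpNorm (weight (-r) : Space d → ENNReal) 2 volume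

theorem prodConst_ne_top {r : ℝ} (hr : (d : ℝ) / 2 < r) (s : ℝ) : prodConst d r s ≠ ⊤ :=
  ENNReal.mul_ne_top ENNReal.ofReal_ne_top (eLpNorm_weight_neg_ne_top hr)

/-- Each high norm meets only the 𝓕L¹ norm of the other factor, controlled by its H^r norm.
Finiteness of A' makes the transform of f integrable, so that f is an inverse Fourier integral. -/
theorem HsBdd.mul_tame {r s : ℝ} (hr : (d : ℝ) / 2 < r) (hs : 0 ≤ s) {f g : Space d → ℂ}
    {A A' B B' : ENNReal} (hA' : A' ≠ ⊤) (hf : HsBdd s f A) (hf' : HsBdd r f A')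
    (hg : HsBdd s g B) (hg' : HsBdd r g B') :
    HsBdd s (fun x => f x * g x) (prodConst d r s * (A' * B + A * B')) := by
  obtain ⟨F, h1, h2⟩ := hf
  obtain ⟨G, h3, h4⟩ := hg
  have hF' := hf'.wNorm_le h1
  have hG' := hg'.wNorm_le h3
  have hi := integrable_fourier hr (ne_top_of_le_ne_top hA' hF')
  have hm := memLp_fourierInv_mul hi G
  refine ⟨hm.toLp _, ?_, ?_⟩
  · filter_upwards [hm.coeFn_toLp, coeFn_eq_fourierInv hi, h1, h3] with x e1 e2 e3 e4
    rw [e1, ← e2, e3, e4]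
  · refine (wNorm_weight_mul_le hs (Lp.stronglyMeasurable _) hi hm.coeFn_toLp).trans ?_
    have hF1 := lintegral_fourier_le r F
    have hG1 := lintegral_fourier_le r G
    change ENNReal.ofReal (2 ^ s) * (_ + _ * wNorm (weight s) F) ≤ _
    rw [prodConst, mul_assoc]
    gcongr
    set E := eLpNorm (weight (-r) : Space d → ENNReal) 2 volume
    calc _ ≤ (E * A') * B + (E * B') * A := by
          gcongr
          · exact hF1.trans (by gcongr)
          · exact hG1.trans (by gcongr)
      _ = _ := by ring

theorem HsBdd.mul {s : ℝ} (hs : (d : ℝ) / 2 < s) {f g : Space d → ℂ}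
    {A B : ENNReal} (hA : A ≠ ⊤) (hf : HsBdd s f A) (hg : HsBdd s g B) :
    HsBdd s (fun x => f x * g x) (2 * prodConst d s s * (A * B)) := by
  have hs0 : 0 ≤ s := le_trans (by positivity) hs.le
  exact (hf.mul_tame hs hs0 hA hf hg hg).mono (le_of_eq (by ring))


/-- Conjugation becomes η ↦ conj(f̂(-η)), and the weight is even. -/
theorem HsBdd.conj {s : ℝ} (hs : (d : ℝ) / 2 < s) {f : Space d → ℂ} {A : ENNReal} (hA : A ≠ ⊤)
    (hf : HsBdd s f A) : HsBdd s (fun x => (starRingEnd ℂ) (f x)) A := by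
  obtain ⟨F, h1, h2⟩ := hf
  have hi := integrable_fourier hs (ne_top_of_le_ne_top hA h2)
  set ψ : Space d → ℂ := fun η => (starRingEnd ℂ) ((𝓕 F : L2 d) (-η)) with hψ
  have hψ1 : Integrable ψ := (Complex.conjLIE.integrable_comp_iff).2 hi.comp_neg
  have hψ2 : MemLp ψ 2 volume := by
    have := (Lp.memLp (𝓕 F : L2 d)).comp_measurePreserving (Measure.measurePreserving_neg volume)
    exact this.star
  have hmem : MemLp (fun x => (starRingEnd ℂ) (F x)) 2 volume := (Lp.memLp F).star
  have hF : (𝓕 (hmem.toLp _ : L2 d) : L2 d) =ᵐ[volume] ψ := by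
    refine fourier_ae_eq_of_eq_fourierInv hψ1 hψ2 ?_
    filter_upwards [hmem.coeFn_toLp, coeFn_eq_fourierInv hi] with x e1 e2
    rw [e1, hψ, fourierInv_conj, ← e2]
  refine ⟨hmem.toLp _, ?_, le_trans (le_of_eq ?_) h2⟩
  · filter_upwards [hmem.coeFn_toLp, h1] with x e1 e2
    rw [e1, e2]
  · have : wNorm (weight s) (hmem.toLp _ : L2 d)
        = eLpNorm ((fun η => weight s η * ‖(𝓕 F : L2 d) η‖ₑ) ∘ Neg.neg) 2 volume := by
      apply eLpNorm_congr_ae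
      filter_upwards [hF] with η e
      rw [e, Function.comp, weight_neg, hψ]
      simp only [RCLike.enorm_conj]
    rw [this, eLpNorm_comp_measurePreserving _ (Measure.measurePreserving_neg volume)]
    · rfl
    · exact ((measurable_weight s).mul (measurable_enorm_fourier F)).aestronglyMeasurable

theorem HsBdd.normSq_tame {r s : ℝ} (hr : (d : ℝ) / 2 < r) (hrs : r ≤ s) {f : Space d → ℂ}
    {A A' : ENNReal} (hA : A ≠ ⊤) (hA' : A' ≠ ⊤) (hf : HsBdd s f A) (hf' : HsBdd r f A') :
    HsBdd s (fun x => ((‖f x‖ ^ 2 : ℝ) : ℂ)) (2 * prodConst d r s * (A * A')) := by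
  have hs := hr.trans_le hrs
  have hs0 : 0 ≤ s := le_trans (by positivity) hs.le
  have h := hf.mul_tame hr hs0 hA' hf' (hf.conj hs hA) (hf'.conj hr hA')
  refine (h.mono (le_of_eq (by ring))).congr (Eventually.of_forall fun x => ?_)
  simp [Complex.mul_conj, Complex.normSq_eq_norm_sq]

theorem HsBdd.normSq {s : ℝ} (hs : (d : ℝ) / 2 < s) {f : Space d → ℂ}
    {A : ENNReal} (hA : A ≠ ⊤) (hf : HsBdd s f A) :
    HsBdd s (fun x => ((‖f x‖ ^ 2 : ℝ) : ℂ)) (2 * prodConst d s s * (A * A)) :=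
  hf.normSq_tame hs le_rfl hA hA hf

/-- From |f|² - |g|² = f · conj(f - g) + (f - g) · conj g. -/
theorem HsBdd.normSq_sub {s : ℝ} (hs : (d : ℝ) / 2 < s) {f g : Space d → ℂ}
    {A y : ENNReal} (hA : A ≠ ⊤) (hy : y ≠ ⊤) (hf : HsBdd s f A) (hg : HsBdd s g A)
    (hfg : HsBdd s (fun x => f x - g x) y) :
    HsBdd s (fun x => ((‖f x‖ ^ 2 : ℝ) : ℂ) - ((‖g x‖ ^ 2 : ℝ) : ℂ))
      (4 * prodConst d s s * A * y) := by
  have h1 := hf.mul hs hA (hfg.conj hs hy)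
  have h2 := hfg.mul hs hy (hg.conj hs hA)
  refine ((h1.add h2).mono (le_of_eq (by ring))).congr (Eventually.of_forall fun x => ?_)
  have e : ∀ z : ℂ, ((‖z‖ ^ 2 : ℝ) : ℂ) = z * (starRingEnd ℂ) z := fun z => by
    simp [Complex.mul_conj, Complex.normSq_eq_norm_sq]
  simp only [e, map_sub]
  ring

theorem HsBdd.pow_mul {s : ℝ} (hs : (d : ℝ) / 2 < s) {b v : Space d → ℂ} {A B : ENNReal}
    (hB : B ≠ ⊤) (hb : HsBdd s b B) (hv : HsBdd s v A) (n : ℕ) :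
    HsBdd s (fun x => b x ^ n * v x) ((2 * prodConst d s s * B) ^ n * A) := by
  induction n with
  | zero => simpa using hv
  | succ n ih =>
    refine ((hb.mul hs hB ih).mono (le_of_eq (by ring))).congr (Eventually.of_forall fun x => ?_)
    simp only; ring

/-- Lipschitz estimate for `(a, u) ↦ a^n u`. -/
theorem exists_hsBdd_pow_mul_sub {s : ℝ} (hs : (d : ℝ) / 2 < s) {A B : ENNReal}
    (hA : A ≠ ⊤) (hB : B ≠ ⊤) (n : ℕ) : ∃ C : ENNReal, C ≠ ⊤ ∧
    ∀ (a b u v : Space d → ℂ) (δ y : ENNReal), δ ≠ ⊤ → HsBdd s a B → HsBdd s b B →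
      HsBdd s (fun x => a x - b x) δ → HsBdd s v A →
      HsBdd s (fun x => u x - v x) y →
      HsBdd s (fun x => a x ^ n * u x - b x ^ n * v x) (C * (y + δ)) := by
  have hK : 2 * prodConst d s s ≠ ⊤ := ENNReal.mul_ne_top (by simp) (prodConst_ne_top hs s)
  set K := 2 * prodConst d s s with hKdef
  induction n with
  | zero => exact ⟨1, by simp, fun a b u v δ y _ _ _ _ _ h => by
      simpa using h.mono (le_self_add (b := δ))⟩
  | succ n ih =>
    obtain ⟨C, hC, h⟩ := ih
    refine ⟨K * B * C + K * ((K * B) ^ n * A), ENNReal.add_ne_top.2 ⟨by finiteness, by finiteness⟩,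
      fun a b u v δ y hδ ha hb hab hv huv => ?_⟩
    -- Telescoping: a^{n+1}u - b^{n+1}v = a(a^n u - b^n v) + (a - b) b^n v.
    have h1 := ha.mul hs hB (h a b u v δ y hδ ha hb hab hv huv)
    have h2 := hab.mul hs hδ (hb.pow_mul hs hB hv n)
    refine ((h1.add h2).mono ?_).congr (Eventually.of_forall fun x => ?_)
    · rw [← hKdef]
      calc K * (B * (C * (y + δ))) + K * (δ * ((K * B) ^ n * A))
          ≤ K * (B * (C * (y + δ))) + K * ((y + δ) * ((K * B) ^ n * A)) := by
            gcongr; exact le_add_self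
        _ = _ := by ring
    · simp only; ring

/-- Tame estimate for `(b, v) ↦ b^n v`. -/
theorem exists_hsBdd_pow_mul_tame {r s : ℝ} (hr : (d : ℝ) / 2 < r) (hs : 0 ≤ s) {A B L : ENNReal}
    (hA : A ≠ ⊤) (hB : B ≠ ⊤) (hL : L ≠ ⊤) (n : ℕ) : ∃ C : ENNReal, C ≠ ⊤ ∧
    ∀ (b v : Space d → ℂ) (y : ENNReal), HsBdd r b B → HsBdd s b (L * y) → HsBdd r v A →
      HsBdd s v y → HsBdd s (fun x => b x ^ n * v x) (C * y) := by
  have hK : prodConst d r s ≠ ⊤ := prodConst_ne_top hr s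
  have hK' : prodConst d r r ≠ ⊤ := prodConst_ne_top hr r
  induction n with
  | zero => exact ⟨1, by simp, fun b v y _ _ _ h => by simpa using h⟩
  | succ n ih =>
    obtain ⟨C, hC, h⟩ := ih
    -- The H^s bound of b is itself L times that of v, as for b = Π|v|². Hence every term is linear
    -- in y.
    refine ⟨prodConst d r s * (B * C + L * ((2 * prodConst d r r * B) ^ n * A)), by finiteness,
      fun b v y hb hb' hv hv' => ?_⟩
    have h1 := hb'.mul_tame hr hs hB hb (h b v y hb hb' hv hv') (hb.pow_mul hr hB hv n)
    refine (h1.mono (le_of_eq (by ring))).congr (Eventually.of_forall fun x => ?_)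
    simp only; ring

/-! ### The frequency cut-off. -/

theorem integrable_normSq (v : L2 d) : Integrable fun x => ((‖v x‖ ^ 2 : ℝ) : ℂ) :=
  ((Lp.memLp v).integrable_norm_pow two_ne_zero).ofReal

theorem lintegral_enorm_normSq (v : L2 d) :
    ∫⁻ x, ‖((‖v x‖ ^ 2 : ℝ) : ℂ)‖ₑ = ‖v‖ₑ ^ 2 := by
  rw [← eLpNorm_two_coeFn, eLpNorm_two_sq]
  congr 1; ext x
  rw [← ofReal_norm, ← ofReal_norm, ← ENNReal.ofReal_pow (norm_nonneg _)]
  simp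

/-- On the Fourier side, the cut-off is the multiplication by its symbol. -/
theorem exists_fourier_cutoff {χ : Space d → ℝ} (hχm : Measurable χ)
    (hχ : ∀ ξ, χ ξ ∈ Icc (0 : ℝ) 1) {g : Space d → ℂ} (hg : Integrable g) {G : L2 d}
    (hG : (G : Space d → ℂ) =ᵐ[volume] g) (hi : Integrable (𝓕 G : L2 d)) :
    ∃ F : L2 d, (F : Space d → ℂ) =ᵐ[volume] cutoff χ g ∧
      (𝓕 F : L2 d) =ᵐ[volume] fun η => (χ ((2 * Real.pi) • η) : ℂ) * (𝓕 G : L2 d) η := by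
  have hm : Measurable fun η : Space d => (χ ((2 * Real.pi) • η) : ℂ) := by fun_prop
  have hb : ∀ η : Space d, ‖(χ ((2 * Real.pi) • η) : ℂ)‖ ≤ 1 := fun η => by
    rw [Complex.norm_real, Real.norm_of_nonneg (hχ _).1]; exact (hχ _).2
  have h1 : Integrable fun η : Space d => (χ ((2 * Real.pi) • η) : ℂ) * (𝓕 G : L2 d) η :=
    hi.bdd_mul hm.aestronglyMeasurable (Eventually.of_forall hb)
  have h2 : MemLp (fun η : Space d => (χ ((2 * Real.pi) • η) : ℂ) * (𝓕 G : L2 d) η) 2 volume :=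
    (Lp.memLp (𝓕 G : L2 d)).of_le_mul (c := 1) (hm.aestronglyMeasurable.mul (Lp.memLp (𝓕 G : L2 d)).1)
      (Eventually.of_forall fun η => by
        rw [norm_mul]; exact mul_le_mul_of_nonneg_right (hb η) (norm_nonneg _))
  have hc : cutoff χ g = 𝓕⁻ (fun η : Space d => (χ ((2 * Real.pi) • η) : ℂ) * (𝓕 G : L2 d) η) := by
    apply fourierInv_congr_ae
    filter_upwards [fourier_L2_eq_integral (hg.congr hG.symm)] with η e
    rw [e, fourier_congr_ae hG]
  have hF : (𝓕 (𝓕⁻ (h2.toLp _ : L2 d) : L2 d) : L2 d) =ᵐ[volume]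
      fun η => (χ ((2 * Real.pi) • η) : ℂ) * (𝓕 G : L2 d) η := by
    rw [FourierTransform.fourier_fourierInv_eq]; exact h2.coeFn_toLp
  refine ⟨𝓕⁻ (h2.toLp _ : L2 d), ?_, hF⟩
  rw [hc, ← fourierInv_congr_ae hF]
  exact coeFn_eq_fourierInv (h1.congr hF.symm)

theorem HsBdd.cutoff {r s : ℝ} (hr : (d : ℝ) / 2 < r) {χ : Space d → ℝ} (hχm : Measurable χ)
    (hχ : ∀ ξ, χ ξ ∈ Icc (0 : ℝ) 1) {g : Space d → ℂ} (hgi : Integrable g) {A A' : ENNReal}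
    (hA' : A' ≠ ⊤) (hg' : HsBdd r g A') (hg : HsBdd s g A) : HsBdd s (cutoff χ g) A := by
  obtain ⟨G, h1, h2⟩ := hg
  obtain ⟨F, h3, h4⟩ := exists_fourier_cutoff hχm hχ hgi h1
    (integrable_fourier hr (ne_top_of_le_ne_top hA' (hg'.wNorm_le h1)))
  refine ⟨F, h3, le_trans ?_ h2⟩
  rw [← one_mul (wNorm (weight s) G)]
  refine wNorm_le_of_ae_le 1 (measurable_weight s) ?_
  filter_upwards [h4] with η e
  rw [e, one_mul, enorm_mul]
  gcongr
  refine mul_le_of_le_one_left' ?_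
  rw [← ofReal_norm, Complex.norm_real, Real.norm_of_nonneg (hχ _).1]
  exact ENNReal.ofReal_le_one.2 (hχ _).2

/-- Here `cutoff` is a Fourier integral of an L¹ function, so its linearity is read off from the L²
multipliers representing the two terms. -/
theorem HsBdd.cutoff_sub {s : ℝ} (hs : (d : ℝ) / 2 < s) {χ : Space d → ℝ} (hχm : Measurable χ)
    (hχ : ∀ ξ, χ ξ ∈ Icc (0 : ℝ) 1) {g₁ g₂ : Space d → ℂ} (hi₁ : Integrable g₁)
    (hi₂ : Integrable g₂) {A₁ A₂ A : ENNReal} (hA₁ : A₁ ≠ ⊤) (hA₂ : A₂ ≠ ⊤)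
    (hg₁ : HsBdd s g₁ A₁) (hg₂ : HsBdd s g₂ A₂) (hg : HsBdd s (fun x => g₁ x - g₂ x) A) :
    HsBdd s (fun x => SaturatedNLS.cutoff χ g₁ x - SaturatedNLS.cutoff χ g₂ x) A := by
  obtain ⟨G₁, h1, h2⟩ := hg₁
  obtain ⟨G₂, h1', h2'⟩ := hg₂
  obtain ⟨F₁, h3, h4⟩ := exists_fourier_cutoff hχm hχ hi₁ h1
    (integrable_fourier hs (ne_top_of_le_ne_top hA₁ h2))
  obtain ⟨F₂, h3', h4'⟩ := exists_fourier_cutoff hχm hχ hi₂ h1'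
    (integrable_fourier hs (ne_top_of_le_ne_top hA₂ h2'))
  have h5 : wNorm (weight s) (G₁ - G₂) ≤ A := hg.wNorm_le (by
    filter_upwards [Lp.coeFn_sub G₁ G₂, h1, h1'] with x e1 e2 e3
    rw [e1, Pi.sub_apply, e2, e3])
  refine ⟨F₁ - F₂, ?_, le_trans ?_ h5⟩
  · filter_upwards [Lp.coeFn_sub F₁ F₂, h3, h3'] with x e1 e2 e3
    rw [e1, Pi.sub_apply, e2, e3]
  rw [← one_mul (wNorm (weight s) (G₁ - G₂))]
  refine wNorm_le_of_ae_le 1 (measurable_weight s) ?_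
  rw [fourier_L2_sub, fourier_L2_sub]
  filter_upwards [h4, h4', Lp.coeFn_sub (𝓕 F₁ : L2 d) (𝓕 F₂), Lp.coeFn_sub (𝓕 G₁ : L2 d) (𝓕 G₂)]
    with η e1 e2 e3 e4
  rw [e3, e4, Pi.sub_apply, Pi.sub_apply, e1, e2, ← mul_sub, one_mul, enorm_mul]
  gcongr
  refine mul_le_of_le_one_left' ?_
  rw [← ofReal_norm, Complex.norm_real, Real.norm_of_nonneg (hχ _).1]
  exact ENNReal.ofReal_le_one.2 (hχ _).2

/-- The error is the multiplier 1 - χ, and its symbol bound trades β derivatives for the factor δ.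
-/
theorem HsBdd.sub_cutoff {s β : ℝ} (hs : (d : ℝ) / 2 < s) (hβ : 0 ≤ β) {χ : Space d → ℝ}
    (hχm : Measurable χ) (hχ : ∀ ξ, χ ξ ∈ Icc (0 : ℝ) 1) {δ : ℝ} (hδ : 0 ≤ δ)
    (hχδ : ∀ ξ, 1 - χ ξ ≤ δ * japaneseBracket ξ ^ β)
    {g : Space d → ℂ} (hgi : Integrable g) {A : ENNReal} (hA : A ≠ ⊤) (hg : HsBdd (s + β) g A) :
    HsBdd s (fun x => g x - SaturatedNLS.cutoff χ g x) (ENNReal.ofReal δ * A) := by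
  obtain ⟨G, h1, h2⟩ := hg
  obtain ⟨F, h3, h4⟩ := exists_fourier_cutoff hχm hχ hgi h1
    (integrable_fourier (hs.trans_le (le_add_of_nonneg_right hβ)) (ne_top_of_le_ne_top hA h2))
  refine ⟨G - F, ?_, le_trans ?_ (mul_le_mul_right h2 _)⟩
  · filter_upwards [Lp.coeFn_sub G F, h1, h3] with x e1 e2 e3
    rw [e1, Pi.sub_apply, e2, e3]
  refine wNorm_le_of_ae_le _ (measurable_weight _) ?_
  rw [fourier_L2_sub]
  filter_upwards [h4, Lp.coeFn_sub (𝓕 G : L2 d) (𝓕 F)] with η e1 e2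
  rw [e2, Pi.sub_apply, e1, ← one_sub_mul, enorm_mul, weight_add_exponent]
  have h5 : ‖(1 - (χ ((2 * Real.pi) • η) : ℂ))‖ₑ ≤ ENNReal.ofReal δ * weight β η := by
    rw [weight, ← ENNReal.ofReal_mul hδ, ← ofReal_norm]
    apply ENNReal.ofReal_le_ofReal
    rw [← Complex.ofReal_one, ← Complex.ofReal_sub, Complex.norm_real,
      Real.norm_of_nonneg (sub_nonneg.2 (hχ _).2)]
    exact hχδ _
  calc _ ≤ weight s η * ((ENNReal.ofReal δ * weight β η) * ‖(𝓕 G : L2 d) η‖ₑ) := by gcongr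
    _ = _ := by ring

/-! ### Estimates of the two nonlinearities. -/

theorem enorm_sign {ε : ℝ} (hε : ε = 1 ∨ ε = -1) : ‖(ε : ℂ)‖ₑ = 1 := by
  rcases hε with rfl | rfl <;> simp

theorem powerNonlinearity_eq (ε : ℝ) (σ : ℕ) (v : Space d → ℂ) :
    powerNonlinearity ε σ v = fun x => (ε : ℂ) * (((‖v x‖ ^ 2 : ℝ) : ℂ) ^ σ * v x) := by
  ext x
  rw [powerNonlinearity, pow_mul]
  push_cast; ring

theorem saturatedNonlinearity_eq (ε : ℝ) (σ : ℕ) (χ : Space d → ℝ) (v : Space d → ℂ) :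
    saturatedNonlinearity ε σ χ v =
      fun x => (ε : ℂ) * (cutoff χ (fun y => ((‖v y‖ ^ 2 : ℝ) : ℂ)) x ^ σ * v x) := by
  ext x
  rw [saturatedNonlinearity, mul_assoc]

theorem exists_hsBdd_powerNonlinearity {s : ℝ} (hs : (d : ℝ) / 2 < s) {ε : ℝ}
    (hε : ε = 1 ∨ ε = -1) (σ : ℕ) {A : ENNReal} (hA : A ≠ ⊤) : ∃ C : ENNReal, C ≠ ⊤ ∧
    ∀ u : Space d → ℂ, HsBdd s u A → HsBdd s (powerNonlinearity ε σ u) C := by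
  have hK := prodConst_ne_top hs s
  refine ⟨(2 * prodConst d s s * (2 * prodConst d s s * (A * A))) ^ σ * A, by finiteness,
    fun u hu => ?_⟩
  rw [powerNonlinearity_eq]
  exact ((hu.normSq hs hA).pow_mul hs (by finiteness) hu σ).const_mul (enorm_sign hε)

/-- With |u|² - Π|v|² = (1 - Π)|u|² + Π(|u|² - |v|²), the loss of β derivatives falls on u alone,
and v is needed only in H^s. -/
theorem exists_hsBdd_nonlinearity_sub {s β : ℝ} (hs : (d : ℝ) / 2 < s) (hβ : 0 ≤ β) {ε : ℝ}
    (hε : ε = 1 ∨ ε = -1) (σ : ℕ) {A : ENNReal} (hA : A ≠ ⊤) : ∃ C : ENNReal, C ≠ ⊤ ∧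
    ∀ (χ : Space d → ℝ), Measurable χ → (∀ ξ, χ ξ ∈ Icc (0 : ℝ) 1) → ∀ δ : ℝ, 0 ≤ δ →
      (∀ ξ, 1 - χ ξ ≤ δ * japaneseBracket ξ ^ β) → ∀ (u v : L2 d) (y : ENNReal), y ≠ ⊤ →
      HsBdd (s + β) u A → HsBdd s v A → HsBdd s (fun x => u x - v x) y →
      HsBdd s (fun x => powerNonlinearity ε σ u x - saturatedNonlinearity ε σ χ v x)
        (C * (y + ENNReal.ofReal δ)) := by
  have hsβ := hs.trans_le (le_add_of_nonneg_right hβ)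
  have hK := prodConst_ne_top hs s
  have hK' := prodConst_ne_top hsβ (s + β)
  set K := prodConst d s s
  set K' := prodConst d (s + β) (s + β)
  obtain ⟨C, hC, h⟩ := exists_hsBdd_pow_mul_sub hs hA (B := 2 * K * (A * A)) (by finiteness) σ
  refine ⟨C * (1 + 4 * K * A + 2 * K' * (A * A)), by finiteness,
    fun χ hχm hχ δ hδ hχδ u v y hy hu hv huv => ?_⟩
  have hu' := hu.mono_exponent (le_add_of_nonneg_right hβ)
  have huu := hu'.normSq hs hA
  have hvv := hv.normSq hs hA
  have h1 := (hu.normSq hsβ hA).sub_cutoff hs hβ hχm hχ hδ hχδ (integrable_normSq u)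
    (by finiteness)
  have h2 := huu.cutoff_sub hs hχm hχ (integrable_normSq u) (integrable_normSq v)
    (by finiteness) (by finiteness) hvv (hu'.normSq_sub hs hA hy hv huv)
  have h3 := (h1.add h2).congr (g := fun x => ((‖u x‖ ^ 2 : ℝ) : ℂ) -
    SaturatedNLS.cutoff χ (fun y => ((‖v y‖ ^ 2 : ℝ) : ℂ)) x)
    (Eventually.of_forall fun x => by ring)
  have h4 := (h _ _ u v _ y (by finiteness) huu
    (hvv.cutoff hs hχm hχ (integrable_normSq v) (by finiteness) hvv) h3 hv huv).const_mul
      (enorm_sign hε)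
  rw [powerNonlinearity_eq, saturatedNonlinearity_eq]
  refine (h4.mono ?_).congr (Eventually.of_forall fun x => by simp only; ring)
  refine (mul_le_mul_right ?_ C).trans (le_of_eq (mul_assoc _ _ _).symm)
  calc y + (ENNReal.ofReal δ * (2 * K' * (A * A)) + 4 * K * A * y)
      = (1 + 4 * K * A) * y + (2 * K' * (A * A)) * ENNReal.ofReal δ := by ring
    _ ≤ (1 + 4 * K * A) * (y + ENNReal.ofReal δ) + (2 * K' * (A * A)) * (y + ENNReal.ofReal δ) := by
        gcongr
        · exact le_self_add
        · exact le_add_self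
    _ = _ := by ring

/-- C depends on the H^r bound A but not on χ, and the estimate is linear in the H^s norm. This
makes a linear Grönwall argument in H^s uniform in h. -/
theorem exists_hsBdd_saturatedNonlinearity_tame {r s : ℝ} (hr : (d : ℝ) / 2 < r) (hrs : r ≤ s)
    {ε : ℝ} (hε : ε = 1 ∨ ε = -1) (σ : ℕ) {A : ENNReal} (hA : A ≠ ⊤) : ∃ C : ENNReal, C ≠ ⊤ ∧
    ∀ (χ : Space d → ℝ), Measurable χ → (∀ ξ, χ ξ ∈ Icc (0 : ℝ) 1) → ∀ (v : L2 d) (y : ENNReal),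
      y ≠ ⊤ → HsBdd r v A → HsBdd s v y → HsBdd s (saturatedNonlinearity ε σ χ v) (C * y) := by
  have hs0 : 0 ≤ s := le_trans (by positivity) (hr.trans_le hrs).le
  have hK := prodConst_ne_top hr r
  have hK' := prodConst_ne_top hr s
  obtain ⟨C, hC, h⟩ := exists_hsBdd_pow_mul_tame (s := s) hr hs0 hA
    (B := 2 * prodConst d r r * (A * A)) (L := 2 * prodConst d r s * A) (by finiteness)
    (by finiteness) σ
  refine ⟨C, hC, fun χ hχm hχ v y hy hv hv' => ?_⟩
  have hvv := hv.normSq hr hA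
  rw [saturatedNonlinearity_eq]
  refine (h _ v y (hvv.cutoff hr hχm hχ (integrable_normSq v) (by finiteness) hvv) ?_ hv
    hv').const_mul (enorm_sign hε)
  exact (hvv.cutoff hr hχm hχ (integrable_normSq v) (by finiteness)
    (hv'.normSq_tame hr hrs hy hA hv)).mono (le_of_eq (by ring))

/-- Bound for the saturated nonlinearity with an integrable symbol, in weighted norms. -/
theorem wNorm_saturatedNonlinearity_le {ε : ℝ} (hε : ε = 1 ∨ ε = -1) (σ : ℕ) {χ : Space d → ℝ}
    (hχm : Measurable χ) {w κ : Space d → ENNReal} (hw : Measurable w) (hκ : Measurable κ)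
    (hκ1 : ∀ x, 1 ≤ κ x) (hwκ : ∀ x y, w (x + y) ≤ κ x * w y)
    (hχi : ∫⁻ η : Space d, κ η * ‖χ ((2 * Real.pi) • η)‖ₑ ≠ ⊤)
    {v G : L2 d} (hG : (G : Space d → ℂ) =ᵐ[volume] saturatedNonlinearity ε σ χ v) :
    wNorm w G ≤ ((∫⁻ η : Space d, κ η * ‖χ ((2 * Real.pi) • η)‖ₑ) * ‖v‖ₑ ^ 2) ^ σ * wNorm w v := by
  -- φ is the transform of Π|v|². As |v|² is in L¹, its transform is bounded by the mass ‖v‖², and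
  -- all decay comes from χ; no regularity of v enters the potential.
  set φ : Space d → ℂ := fun η => (χ ((2 * Real.pi) • η) : ℂ) *
    𝓕 (fun y => ((‖v y‖ ^ 2 : ℝ) : ℂ)) η with hφ
  have hφm : StronglyMeasurable φ := by
    refine StronglyMeasurable.mul ?_
      (continuous_fourier_of_integrable (integrable_normSq v)).stronglyMeasurable
    exact (Measurable.stronglyMeasurable (by fun_prop))
  have hφb : ∀ η, ‖φ η‖ₑ ≤ ‖χ ((2 * Real.pi) • η)‖ₑ * ‖v‖ₑ ^ 2 := fun η => by
    rw [hφ, enorm_mul, ← lintegral_enorm_normSq]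
    gcongr
    · rw [← ofReal_norm, ← ofReal_norm, Complex.norm_real]
    · exact enorm_fourier_le _ η
  have hI : ∫⁻ η, κ η * ‖φ η‖ₑ ≤ (∫⁻ η : Space d, κ η * ‖χ ((2 * Real.pi) • η)‖ₑ) * ‖v‖ₑ ^ 2 := by
    rw [← lintegral_mul_const' _ _ (by finiteness)]
    refine lintegral_mono fun η => ?_
    rw [mul_assoc]
    exact mul_le_mul_right (hφb η) _
  have hφi : Integrable φ := by
    refine ⟨hφm.aestronglyMeasurable, lt_of_le_of_lt (lintegral_mono fun η => ?_)
      (hI.trans_lt (by finiteness))⟩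
    exact le_mul_of_one_le_left' (hκ1 η)
  have key : ∀ n, ∃ H : L2 d, ((H : Space d → ℂ) =ᵐ[volume] fun x => 𝓕⁻ φ x ^ n * v x) ∧
      wNorm w H ≤ ((∫⁻ η : Space d, κ η * ‖χ ((2 * Real.pi) • η)‖ₑ) * ‖v‖ₑ ^ 2) ^ n * wNorm w v := by
    intro n
    induction n with
    | zero => exact ⟨v, by simp, by simp⟩
    | succ n ih =>
      obtain ⟨H, h1, h2⟩ := ih
      refine ⟨(memLp_fourierInv_mul hφi H).toLp _, ?_, ?_⟩
      · filter_upwards [(memLp_fourierInv_mul hφi H).coeFn_toLp, h1] with x e1 e2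
        rw [e1, e2]; ring
      · refine (wNorm_mul_le hφm hφi (memLp_fourierInv_mul hφi H).coeFn_toLp hw hκ hwκ).trans ?_
        rw [pow_succ', mul_assoc]
        gcongr
  obtain ⟨H, h1, h2⟩ := key σ
  have hGH : G = (ε : ℂ) • H := by
    apply Lp.ext
    filter_upwards [hG, h1, Lp.coeFn_smul (ε : ℂ) H] with x e1 e2 e3
    rw [e1, e3, Pi.smul_apply, e2, saturatedNonlinearity_eq, smul_eq_mul]
    rfl
  rw [hGH, wNorm_smul _ _ (enorm_sign hε)]
  exact h2

/-- A real even symbol maps real functions to real functions. -/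
theorem conj_cutoff_normSq {χ : Space d → ℝ} (hχ : ∀ ξ, χ (-ξ) = χ ξ) (v : Space d → ℂ) (x : Space d) :
    (starRingEnd ℂ) (cutoff χ (fun y => ((‖v y‖ ^ 2 : ℝ) : ℂ)) x)
      = cutoff χ (fun y => ((‖v y‖ ^ 2 : ℝ) : ℂ)) x := by
  rw [cutoff, ← fourierInv_conj]
  refine congrArg (fun ψ : Space d → ℂ => 𝓕⁻ ψ x) (funext fun η => ?_)
  rw [map_mul, Complex.conj_ofReal, smul_neg, hχ, ← fourier_conj]
  simp only [Complex.conj_ofReal]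

/-- The potential ε(Π|v|²)^σ is real, so the integrand conj(v) G is real. This is the source of mass
conservation. -/
theorem inner_saturatedNonlinearity_im {ε : ℝ} {σ : ℕ} {χ : Space d → ℝ}
    (hχ : ∀ ξ, χ (-ξ) = χ ξ) {v G : L2 d}
    (hG : (G : Space d → ℂ) =ᵐ[volume] saturatedNonlinearity ε σ χ v) :
    (inner ℂ v G).im = 0 := by
  rw [← Complex.conj_eq_iff_im, L2.inner_def, ← integral_conj]
  apply integral_congr_ae
  filter_upwards [hG] with x e
  rw [e, saturatedNonlinearity]
  simp only [RCLike.inner_apply, map_mul, map_pow, conj_cutoff_normSq hχ, Complex.conj_ofReal,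
    Complex.conj_conj]
  ring

/-! ### The unitary group. -/

theorem fourier_L2_injective : Function.Injective fun f : L2 d => (𝓕 f : L2 d) :=
  (Lp.fourierTransformₗᵢ (Space d) ℂ).injective

/-- The propagator as a linear isometry. -/
def propagatorIsometry {P : Space d → ℝ} (hP : Measurable P) (t : ℝ) : L2 d →ₗᵢ[ℂ] L2 d where
  toFun := propagator P t
  map_add' f g := by
    apply fourier_L2_injective
    dsimp only
    rw [FourierTransform.fourier_add]
    apply Lp.ext
    filter_upwards [fourier_propagator hP t (f + g), fourier_propagator hP t f,
      fourier_propagator hP t g, Lp.coeFn_add (𝓕 (propagator P t f) : L2 d) (𝓕 (propagator P t g)),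
      Lp.coeFn_add (𝓕 f : L2 d) (𝓕 g)] with η e1 e2 e3 e4 e5
    rw [e1, e4, Pi.add_apply, e2, e3, FourierTransform.fourier_add, e5, Pi.add_apply, mul_add]
  map_smul' c f := by
    apply fourier_L2_injective
    dsimp only
    rw [RingHom.id_apply, FourierTransform.fourier_smul]
    apply Lp.ext
    filter_upwards [fourier_propagator hP t (c • f), fourier_propagator hP t f,
      Lp.coeFn_smul c (𝓕 (propagator P t f) : L2 d), Lp.coeFn_smul c (𝓕 f : L2 d)]
      with η e1 e2 e3 e4
    rw [e1, e3, Pi.smul_apply, e2, FourierTransform.fourier_smul, e4, Pi.smul_apply, smul_eq_mul,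
      smul_eq_mul]
    ring
  norm_map' f := by
    change ‖propagator P t f‖ = ‖f‖
    rw [← Lp.norm_fourier_eq, ← Lp.norm_fourier_eq f, Lp.norm_def, Lp.norm_def]
    congr 1
    apply eLpNorm_congr_norm_ae
    filter_upwards [fourier_propagator hP t f] with η e
    rw [e, norm_mul, mul_comm Complex.I, Complex.norm_exp_ofReal_mul_I, one_mul]

theorem propagatorIsometry_apply {P : Space d → ℝ} (hP : Measurable P) (t : ℝ) (f : L2 d) :
    propagatorIsometry hP t f = propagator P t f := rfl

theorem propagator_propagator {P : Space d → ℝ} (hP : Measurable P) (t r : ℝ) (f : L2 d) :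
    propagator P t (propagator P r f) = propagator P (t + r) f := by
  apply fourier_L2_injective
  apply Lp.ext
  filter_upwards [fourier_propagator hP t (propagator P r f), fourier_propagator hP r f,
    fourier_propagator hP (t + r) f] with η e1 e2 e3
  rw [e1, e2, e3, ← mul_assoc, ← Complex.exp_add]
  congr 2; push_cast; ring

theorem propagator_zero {P : Space d → ℝ} (hP : Measurable P) (f : L2 d) :
    propagator P 0 f = f := by
  apply fourier_L2_injective
  apply Lp.ext
  filter_upwards [fourier_propagator hP 0 f] with η e
  rw [e]; simp

theorem wNorm_propagator {w : Space d → ENNReal} {P : Space d → ℝ} (hP : Measurable P) (t : ℝ)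
    (f : L2 d) : wNorm w (propagator P t f) = wNorm w f := by
  apply eLpNorm_congr_ae
  filter_upwards [fourier_propagator hP t f] with η e
  rw [e, enorm_mul, ← ofReal_norm (Complex.exp _), mul_comm Complex.I,
    Complex.norm_exp_ofReal_mul_I]
  simp

theorem enorm_exp_sub_exp_le (a b : ℝ) :
    ‖Complex.exp (Complex.I * (a : ℝ)) - Complex.exp (Complex.I * (b : ℝ))‖ₑ
      ≤ ENNReal.ofReal |a - b| := by
  rw [← ofReal_norm]
  apply ENNReal.ofReal_le_ofReal
  have h : Complex.exp (Complex.I * (a : ℝ)) - Complex.exp (Complex.I * (b : ℝ))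
      = Complex.exp (Complex.I * (b : ℝ)) * (Complex.exp (Complex.I * ((a - b : ℝ) : ℂ)) - 1) := by
    rw [mul_sub, ← Complex.exp_add, mul_one]
    congr 2; push_cast; ring
  rw [h, norm_mul, mul_comm Complex.I (b : ℂ), Complex.norm_exp_ofReal_mul_I, one_mul]
  simpa using Real.norm_exp_I_mul_ofReal_sub_one_le (x := a - b)

/-- On the Fourier side |e^{itP} - e^{itQ}| ≤ |t||P - Q|, so closeness of symbols up to ⟨ξ⟩^β costs
β derivatives. -/
theorem wNorm_propagator_sub_le {s β : ℝ} {P Q : Space d → ℝ} (hP : Measurable P)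
    (hQ : Measurable Q) {c : ℝ} (hc : 0 ≤ c) (hPQ : ∀ ξ, |P ξ - Q ξ| ≤ c * japaneseBracket ξ ^ β)
    (t : ℝ) (f : L2 d) :
    wNorm (weight s) (propagator P t f - propagator Q t f)
      ≤ ENNReal.ofReal (|t| * c) * wNorm (weight (s + β)) f := by
  refine wNorm_le_of_ae_le _ (measurable_weight _) ?_
  rw [fourier_L2_sub]
  filter_upwards [fourier_propagator hP t f, fourier_propagator hQ t f,
    Lp.coeFn_sub (𝓕 (propagator P t f) : L2 d) (𝓕 (propagator Q t f))] with η e1 e2 e3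
  rw [e3, Pi.sub_apply, e1, e2, ← sub_mul, enorm_mul, weight_add_exponent]
  have h : ENNReal.ofReal |t * P ((2 * Real.pi) • η) - t * Q ((2 * Real.pi) • η)|
      ≤ ENNReal.ofReal (|t| * c) * weight β η := by
    rw [weight, ← ENNReal.ofReal_mul (by positivity)]
    apply ENNReal.ofReal_le_ofReal
    rw [← mul_sub, abs_mul, mul_assoc]
    exact mul_le_mul_of_nonneg_left (hPQ _) (abs_nonneg _)
  calc _ ≤ weight s η * ((ENNReal.ofReal (|t| * c) * weight β η) * ‖(𝓕 f : L2 d) η‖ₑ) := by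
        gcongr
        exact (enorm_exp_sub_exp_le _ _).trans h
    _ = _ := by ring

/-- Strong continuity of the unitary group. -/
theorem continuous_propagator {P : Space d → ℝ} (hP : Measurable P) (f : L2 d) :
    Continuous fun t => propagator P t f := by
  rw [continuous_iff_continuousAt]
  intro t₀
  rw [ContinuousAt, tendsto_iff_edist_tendsto_0]
  set D : ℝ → Space d → ENNReal := fun t η =>
    ‖(Complex.exp (Complex.I * (t * P ((2 * Real.pi) • η) : ℝ))
      - Complex.exp (Complex.I * (t₀ * P ((2 * Real.pi) • η) : ℝ))) * (𝓕 f : L2 d) η‖ₑ with hD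
  have h1 : ∀ t, edist (propagator P t f) (propagator P t₀ f) = eLpNorm (D t) 2 volume := by
    intro t
    rw [edist_eq_enorm_sub, ← wNorm_one, wNorm, fourier_L2_sub]
    apply eLpNorm_congr_ae
    filter_upwards [fourier_propagator hP t f, fourier_propagator hP t₀ f,
      Lp.coeFn_sub (𝓕 (propagator P t f) : L2 d) (𝓕 (propagator P t₀ f))] with η e1 e2 e3
    rw [e3, Pi.sub_apply, e1, e2, ← sub_mul, Pi.one_apply, one_mul]
  simp only [h1]
  have hfm : Measurable ((𝓕 f : L2 d) : Space d → ℂ) := (Lp.stronglyMeasurable (𝓕 f : L2 d)).measurable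
  refine tendsto_eLpNorm_two_zero (b := fun η => 2 * ‖(𝓕 f : L2 d) η‖ₑ) (fun t => ?_) ?_ ?_ ?_
  · have : Measurable fun η : Space d => P ((2 * Real.pi) • η) := by fun_prop
    fun_prop
  · have : eLpNorm (fun η => 2 * ‖(𝓕 f : L2 d) η‖ₑ) 2 volume
        ≤ 2 * eLpNorm (fun η => ‖(𝓕 f : L2 d) η‖ₑ) 2 volume :=
      eLpNorm_le_mul_eLpNorm_of_ae_le_mul'' 2 (measurable_enorm_fourier f).aestronglyMeasurable
        (Eventually.of_forall fun η => by simp)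
    refine ne_top_of_le_ne_top ?_ this
    rw [eLpNorm_two_coeFn]
    finiteness
  · refine fun t => Eventually.of_forall fun η => ?_
    simp only [hD, enorm_mul]
    gcongr
    refine enorm_sub_le.trans ?_
    rw [← ofReal_norm, ← ofReal_norm, mul_comm Complex.I, mul_comm Complex.I,
      Complex.norm_exp_ofReal_mul_I, Complex.norm_exp_ofReal_mul_I]
    norm_num
  · refine Eventually.of_forall fun η => ?_
    have hc : Continuous fun t => D t η := by
      rw [hD]
      fun_prop
    have := hc.tendsto t₀
    simpa [hD] using this

/-- Strong continuity and the isometry property give joint continuity, hence measurability of τ ↦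
S(θ(τ))F(τ). -/
theorem continuous_propagator_uncurry {P : Space d → ℝ} (hP : Measurable P) :
    Continuous fun p : ℝ × L2 d => propagator P p.1 p.2 := by
  refine continuous_prod_of_continuous_lipschitzWith' _ 1 (fun t => (propagatorIsometry hP t).lipschitz)
    fun f => continuous_propagator hP f

theorem integrableOn_propagator {P : Space d → ℝ} (hP : Measurable P) {F : ℝ → L2 d} {S : Set ℝ}
    (hF : IntegrableOn F S volume) {θ : ℝ → ℝ} (hθ : Continuous θ) :
    IntegrableOn (fun τ => propagator P (θ τ) (F τ)) S volume := by
  have h1 : AEStronglyMeasurable (fun τ => (θ τ, F τ)) (volume.restrict S) :=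
    AEStronglyMeasurable.prodMk hθ.aestronglyMeasurable hF.1
  have h2 := (continuous_propagator_uncurry hP).comp_aestronglyMeasurable h1
  exact Integrable.mono hF h2 (Eventually.of_forall fun τ =>
    ((propagatorIsometry hP (θ τ)).norm_map (F τ)).le)

/-! ### Conservation of mass for Duhamel solutions. -/

/-- Conservation of mass. -/
theorem norm_eq_of_duhamel {P : Space d → ℝ} (hP : Measurable P) {T : ℝ} {u₀ : L2 d}
    {v F : ℝ → L2 d} (hF : IntegrableOn F (Icc 0 T) volume) {K : ℝ}
    (hFK : ∀ᵐ τ ∂(volume.restrict (Icc (0 : ℝ) T)), ‖F τ‖ ≤ K)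
    (hFv : ∀ᵐ τ ∂(volume.restrict (Icc (0 : ℝ) T)), (inner ℂ (v τ) (F τ)).im = 0)
    (hv : ∀ t ∈ Icc (0 : ℝ) T,
      v t = propagator P t u₀ - Complex.I • ∫ τ in (0 : ℝ)..t, propagator P (t - τ) (F τ)) :
    ∀ t ∈ Icc (0 : ℝ) T, ‖v t‖ = ‖u₀‖ := by
  -- Interaction picture: undoing the group turns Duhamel's formula into g(t) = u₀ + ∫₀ᵗ f, with
  -- ‖g(t)‖ = ‖v(t)‖.
  set f : ℝ → L2 d := fun τ => -Complex.I • propagator P (-τ) (F τ) with hf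
  set g : ℝ → L2 d := fun t => propagator P (-t) (v t) with hg
  have hfi : IntegrableOn f (Icc 0 T) volume :=
    Integrable.smul (-Complex.I) (integrableOn_propagator hP hF continuous_neg)
  have hfi' : ∀ a ∈ Icc 0 T, ∀ b ∈ Icc 0 T, IntervalIntegrable f volume a b := fun a ha b hb =>
    (hfi.mono_set (uIcc_subset_Icc ha hb)).intervalIntegrable
  have hgf : ∀ t ∈ Icc 0 T, g t = u₀ + ∫ τ in (0 : ℝ)..t, f τ := by
    intro t ht
    have h1 : g t = propagatorIsometry hP (-t) (v t) := rfl
    have h2 := (propagatorIsometry hP (-t)).toContinuousLinearMap.intervalIntegral_comp_comm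
      (μ := volume) (a := 0) (b := t) (f := fun τ => propagator P (t - τ) (F τ))
      ((integrableOn_propagator hP hF (continuous_const.sub continuous_id)).mono_set
        (uIcc_subset_Icc ⟨le_rfl, ht.1.trans ht.2⟩ ht)).intervalIntegrable
    rw [h1, hv t ht, map_sub, map_smul, propagatorIsometry_apply, propagator_propagator hP,
      neg_add_cancel, propagator_zero hP]
    simp only [LinearIsometry.coe_toContinuousLinearMap] at h2
    rw [← h2, hf, intervalIntegral.integral_smul, neg_smul, sub_eq_add_neg]
    congr 3
    apply intervalIntegral.integral_congr
    intro τ _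
    dsimp only
    rw [propagatorIsometry_apply, propagator_propagator hP]
    congr 1; ring
  have hK0 : 0 ≤ |K| := abs_nonneg K
  have hgsub : ∀ a ∈ Icc 0 T, ∀ b ∈ Icc 0 T, g b - g a = ∫ τ in a..b, f τ := by
    intro a ha b hb
    have h0 : (0 : ℝ) ∈ Icc 0 T := ⟨le_rfl, ha.1.trans ha.2⟩
    rw [hgf a ha, hgf b hb, add_sub_add_left_eq_sub,
      intervalIntegral.integral_interval_sub_left (hfi' 0 h0 b hb) (hfi' 0 h0 a ha)]
  have hae : ∀ a ∈ Icc 0 T, ∀ b ∈ Icc 0 T, ∀ p : ℝ → Prop,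
      (∀ᵐ τ ∂(volume.restrict (Icc (0 : ℝ) T)), p τ) → ∀ᵐ τ, τ ∈ uIoc a b → p τ := by
    intro a ha b hb p hp
    rw [ae_restrict_iff' measurableSet_Icc] at hp
    filter_upwards [hp] with τ h1 h2
    exact h1 ((uIcc_subset_Icc ha hb) (uIoc_subset_uIcc h2))
  have hfK : ∀ᵐ τ ∂(volume.restrict (Icc (0 : ℝ) T)), ‖f τ‖ ≤ |K| := by
    filter_upwards [hFK] with τ h
    rw [hf, norm_smul, norm_neg, Complex.norm_I, one_mul]
    exact ((propagatorIsometry hP (-τ)).norm_map (F τ)).le.trans (h.trans (le_abs_self K))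
  have hlip : ∀ a ∈ Icc 0 T, ∀ b ∈ Icc 0 T, ‖g b - g a‖ ≤ |K| * |b - a| := by
    intro a ha b hb
    rw [hgsub a ha b hb]
    exact intervalIntegral.norm_integral_le_of_norm_le_const_ae (hae a ha b hb _ hfK)
  have horth : ∀ᵐ τ ∂(volume.restrict (Icc (0 : ℝ) T)), (inner ℂ (g τ) (f τ)).re = 0 := by
    filter_upwards [hFv] with τ h
    have h1 : inner ℂ (g τ) (f τ) = -Complex.I * inner ℂ (v τ) (F τ) := by
      rw [hf, inner_smul_right]
      congr 1
      exact (propagatorIsometry hP (-τ)).inner_map_map (v τ) (F τ)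
    rw [h1]
    simp [h]
  -- Since Re⟨g(τ), f(τ)⟩ = 0 for almost every τ, g(a) may be replaced by g(a) - g(τ) under the
  -- integral, which is O(|b - a|). The increment of ‖g‖² is then quadratic in b - a, so its
  -- derivative vanishes everywhere although f is known only almost everywhere.
  have hquad : ∀ a ∈ Icc 0 T, ∀ b ∈ Icc 0 T,
      |‖g b‖ ^ 2 - ‖g a‖ ^ 2| ≤ 3 * |K| ^ 2 * |b - a| ^ 2 := by
    intro a ha b hb
    have h1 : ‖g b‖ ^ 2 - ‖g a‖ ^ 2 = 2 * (inner ℂ (g a) (g b - g a)).re + ‖g b - g a‖ ^ 2 := by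
      have := norm_add_sq (𝕜 := ℂ) (g a) (g b - g a)
      rw [add_sub_cancel] at this
      have h2 : RCLike.re (inner ℂ (g a) (g b - g a)) = (inner ℂ (g a) (g b - g a)).re := rfl
      rw [this, h2]
      ring
    have h2 : (inner ℂ (g a) (g b - g a)).re = ∫ τ in a..b, (inner ℂ (g a) (f τ)).re := by
      rw [hgsub a ha b hb]
      exact ((Complex.reCLM.comp ((innerSL ℂ (g a)).restrictScalars ℝ)).intervalIntegral_comp_comm
        (hfi' a ha b hb)).symm
    have h3 : |(inner ℂ (g a) (g b - g a)).re| ≤ |K| ^ 2 * |b - a| * |b - a| := by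
      rw [h2, ← Real.norm_eq_abs]
      apply intervalIntegral.norm_integral_le_of_norm_le_const_ae
      filter_upwards [hae a ha b hb _ hfK, hae a ha b hb _ horth] with τ e1 e2 hτ
      have hτT : τ ∈ Icc 0 T := (uIcc_subset_Icc ha hb) (uIoc_subset_uIcc hτ)
      have hτab : |τ - a| ≤ |b - a| := abs_sub_left_of_mem_uIcc (uIoc_subset_uIcc hτ)
      have e3 : (inner ℂ (g a) (f τ)).re = (inner ℂ (g a - g τ) (f τ)).re := by
        rw [inner_sub_left, Complex.sub_re, e2 hτ, sub_zero]
      rw [e3]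
      calc ‖(inner ℂ (g a - g τ) (f τ)).re‖ ≤ ‖inner ℂ (g a - g τ) (f τ)‖ :=
            Complex.abs_re_le_norm _
        _ ≤ ‖g a - g τ‖ * ‖f τ‖ := norm_inner_le_norm _ _
        _ ≤ (|K| * |τ - a|) * |K| := by
            gcongr
            · rw [norm_sub_rev]; exact hlip a ha τ hτT
            · exact e1 hτ
        _ ≤ (|K| * |b - a|) * |K| := by gcongr
        _ = _ := by ring
    have h4 : ‖g b - g a‖ ^ 2 ≤ (|K| * |b - a|) ^ 2 := by
      gcongr; exact hlip a ha b hb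
    rw [h1]
    rw [abs_le] at h3 ⊢
    constructor <;> nlinarith [sq_nonneg ‖g b - g a‖]
  have hder : ∀ x ∈ Icc 0 T, HasDerivWithinAt (fun t => ‖g t‖ ^ 2) 0 (Icc 0 T) x := by
    intro x hx
    rw [hasDerivWithinAt_iff_isLittleO]
    have hO : (fun y => ‖g y‖ ^ 2 - ‖g x‖ ^ 2 - (y - x) • (0 : ℝ)) =O[𝓝[Icc 0 T] x]
        fun y => (y - x) ^ 2 := by
      refine Asymptotics.IsBigO.of_bound (3 * |K| ^ 2) ?_
      filter_upwards [self_mem_nhdsWithin] with y hy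
      simpa using hquad x hx y hy
    refine hO.trans_isLittleO ?_
    have : (fun y : ℝ => (y - x) ^ 2) =o[𝓝 x] fun y => y - x := by
      simpa using Asymptotics.isLittleO_pow_sub_sub x (m := 2) one_lt_two
    exact this.mono nhdsWithin_le_nhds
  intro t ht
  have hT0 : 0 ≤ T := ht.1.trans ht.2
  have hconst : ‖g t‖ ^ 2 = ‖g 0‖ ^ 2 := by
    rcases hT0.eq_or_lt with h | h
    · have : t = 0 := le_antisymm (h ▸ ht.2) ht.1
      rw [this]
    · exact constant_of_derivWithin_zero (fun x hx => (hder x hx).differentiableWithinAt)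
        (fun x hx => (hder x (Ico_subset_Icc_self hx)).derivWithin
          (uniqueDiffOn_Icc h x (Ico_subset_Icc_self hx))) t ht
  have h0 : g 0 = u₀ := by
    rw [hgf 0 ⟨le_rfl, hT0⟩]; simp
  have ht' : ‖g t‖ = ‖v t‖ := (propagatorIsometry hP (-t)).norm_map (v t)
  rw [← ht', ← h0]
  exact (pow_left_inj₀ (norm_nonneg _) (norm_nonneg _) two_ne_zero).1 hconst

/-! ### Grönwall and bootstrap inequalities. -/

/-- The rate 2L makes y ↦ L∫y a contraction by 1/2 in the sup norm weighted by e^{-2Lt}. -/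
theorem lintegral_exp_le {L t : ℝ} (hL : 0 ≤ L) (ht : 0 ≤ t) :
    ENNReal.ofReal L * ∫⁻ τ in Ioc 0 t, ENNReal.ofReal (Real.exp (2 * L * τ))
      ≤ ENNReal.ofReal (Real.exp (2 * L * t)) / 2 := by
  have hc : Continuous fun τ : ℝ => Real.exp (2 * L * τ) := by fun_prop
  have hi : IntegrableOn (fun τ : ℝ => Real.exp (2 * L * τ)) (Ioc 0 t) volume :=
    (hc.integrableOn_Icc).mono_set Ioc_subset_Icc_self
  rw [← ofReal_integral_eq_lintegral_ofReal hi (Eventually.of_forall fun τ => (Real.exp_pos _).le),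
    ← intervalIntegral.integral_of_le ht, ← ENNReal.ofReal_mul hL]
  have h1 : L * ∫ τ in (0 : ℝ)..t, Real.exp (2 * L * τ) = (Real.exp (2 * L * t) - 1) / 2 := by
    rw [← intervalIntegral.integral_const_mul]
    have := intervalIntegral.integral_eq_sub_of_hasDerivAt (a := 0) (b := t)
      (f := fun τ => Real.exp (2 * L * τ) / 2) (f' := fun τ => L * Real.exp (2 * L * τ))
      (fun τ _ => by
        have h := (((hasDerivAt_id τ).const_mul (2 * L)).exp).div_const 2
        exact h.congr_deriv (by simp only [id_eq, mul_one]; ring)) ((hc.const_mul L).intervalIntegrable _ _)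
    rw [this]
    simp; ring
  rw [h1, show (2 : ENNReal) = ENNReal.ofReal 2 by simp, ← ENNReal.ofReal_div_of_pos (by norm_num)]
  apply ENNReal.ofReal_le_ofReal
  linarith

/-- Grönwall's inequality for bounded functions with values in `[0,∞]`. -/
theorem gronwall_ennreal {y : ℝ → ENNReal} {t₀ L : ℝ} {a B : ENNReal} (hL : 0 ≤ L)
    (hB : B ≠ ⊤) (hyB : ∀ t ∈ Icc 0 t₀, y t ≤ B)
    (hy : ∀ t ∈ Icc 0 t₀, y t ≤ a + ENNReal.ofReal L * ∫⁻ τ in Ioc 0 t, y τ) :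
    ∀ t ∈ Icc 0 t₀, y t ≤ 2 * a * ENNReal.ofReal (Real.exp (2 * L * t)) := by
  -- Working with the weighted supremum gives M ≤ a + M/2 and avoids any measurability of y. The a
  -- priori bound B serves only to make M finite, so that M/2 can be cancelled.
  set M : ENNReal := ⨆ t ∈ Icc 0 t₀, y t * ENNReal.ofReal (Real.exp (-(2 * L * t))) with hM
  have hexp : ∀ t : ℝ, ENNReal.ofReal (Real.exp (-(2 * L * t))) *
      ENNReal.ofReal (Real.exp (2 * L * t)) = 1 := fun t => by
    rw [← ENNReal.ofReal_mul (Real.exp_pos _).le, ← Real.exp_add]; simp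
  have hMB : M ≤ B := by
    refine iSup₂_le fun t ht => ?_
    calc y t * ENNReal.ofReal (Real.exp (-(2 * L * t))) ≤ B * 1 := by
          gcongr
          · exact hyB t ht
          · rw [ENNReal.ofReal_le_one, Real.exp_le_one_iff]
            have := ht.1
            nlinarith
      _ = B := mul_one B
  have hyM : ∀ t ∈ Icc 0 t₀, y t ≤ M * ENNReal.ofReal (Real.exp (2 * L * t)) := fun t ht => by
    have h : y t * ENNReal.ofReal (Real.exp (-(2 * L * t))) ≤ M :=
      le_iSup₂ (f := fun t (_ : t ∈ Icc 0 t₀) => y t * ENNReal.ofReal (Real.exp (-(2 * L * t)))) t ht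
    calc y t = y t * ENNReal.ofReal (Real.exp (-(2 * L * t))) *
          ENNReal.ofReal (Real.exp (2 * L * t)) := by rw [mul_assoc, hexp, mul_one]
      _ ≤ _ := by gcongr
  have hMle : M ≤ a + M / 2 := by
    refine iSup₂_le fun t ht => ?_
    have h1 : y t ≤ a + M * (ENNReal.ofReal (Real.exp (2 * L * t)) / 2) := by
      refine (hy t ht).trans (add_le_add le_rfl ?_)
      calc ENNReal.ofReal L * ∫⁻ τ in Ioc 0 t, y τ
          ≤ ENNReal.ofReal L * ∫⁻ τ in Ioc 0 t, M * ENNReal.ofReal (Real.exp (2 * L * τ)) := by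
            refine mul_le_mul_right (setLIntegral_mono' measurableSet_Ioc fun τ hτ => ?_) _
            exact hyM τ ⟨hτ.1.le, hτ.2.trans ht.2⟩
        _ = M * (ENNReal.ofReal L * ∫⁻ τ in Ioc 0 t, ENNReal.ofReal (Real.exp (2 * L * τ))) := by
            rw [lintegral_const_mul' _ _ (ne_top_of_le_ne_top hB hMB)]; ring
        _ ≤ _ := by
            gcongr
            exact lintegral_exp_le hL ht.1
    calc y t * ENNReal.ofReal (Real.exp (-(2 * L * t)))
        ≤ (a + M * (ENNReal.ofReal (Real.exp (2 * L * t)) / 2)) *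
          ENNReal.ofReal (Real.exp (-(2 * L * t))) := by gcongr
      _ = a * ENNReal.ofReal (Real.exp (-(2 * L * t))) + M / 2 *
          (ENNReal.ofReal (Real.exp (-(2 * L * t))) * ENNReal.ofReal (Real.exp (2 * L * t))) := by
          rw [ENNReal.div_eq_inv_mul, ENNReal.div_eq_inv_mul]; ring
      _ ≤ a * 1 + M / 2 * 1 := by
          rw [hexp]
          gcongr
          rw [ENNReal.ofReal_le_one, Real.exp_le_one_iff]
          have := ht.1
          nlinarith
      _ = a + M / 2 := by rw [mul_one, mul_one]
  have hM2 : M ≤ 2 * a := by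
    have hMt : M ≠ ⊤ := ne_top_of_le_ne_top hB hMB
    have h1 : M / 2 + M / 2 ≤ a + M / 2 := by rwa [ENNReal.add_halves]
    have h2 : M / 2 ≤ a := (ENNReal.add_le_add_iff_right (ENNReal.div_ne_top hMt (by simp))).1 h1
    calc M = 2 * (M / 2) := by rw [ENNReal.mul_div_cancel (by simp) (by simp)]
      _ ≤ 2 * a := by gcongr
  intro t ht
  exact (hyM t ht).trans (by gcongr)

/-- Grönwall's inequality with a source that is controlled almost everywhere. -/
theorem gronwall_ennreal_source {y N : ℝ → ENNReal} {t₀ T L : ℝ} {a δ B : ENNReal} (hL : 0 ≤ L)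
    (htT : t₀ ≤ T) (hB : B ≠ ⊤) (hyB : ∀ t ∈ Icc 0 t₀, y t ≤ B)
    (hy : ∀ t ∈ Icc 0 t₀, y t ≤ a + ∫⁻ τ in Ioc 0 t, N τ)
    (hN : ∀ᵐ τ, τ ∈ Icc 0 t₀ → N τ ≤ ENNReal.ofReal L * (y τ + δ)) :
    ∀ t ∈ Icc 0 t₀,
      y t ≤ 2 * (a + ENNReal.ofReal L * ENNReal.ofReal T * δ) *
        ENNReal.ofReal (Real.exp (2 * L * t)) := by
  refine gronwall_ennreal hL hB hyB fun t ht => (hy t ht).trans ?_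
  rw [add_assoc]
  gcongr
  calc ∫⁻ τ in Ioc 0 t, N τ
      ≤ ∫⁻ τ in Ioc 0 t, ENNReal.ofReal L * (δ + y τ) := by
        refine lintegral_mono_ae ?_
        rw [ae_restrict_iff' measurableSet_Ioc]
        filter_upwards [hN] with τ h hτ
        rw [add_comm]
        exact h ⟨hτ.1.le, hτ.2.trans ht.2⟩
    _ = ENNReal.ofReal L * (ENNReal.ofReal t * δ + ∫⁻ τ in Ioc 0 t, y τ) := by
        rw [lintegral_const_mul' _ _ ENNReal.ofReal_ne_top, lintegral_add_left measurable_const]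
        simp [mul_comm]
    _ ≤ ENNReal.ofReal L * (ENNReal.ofReal T * δ + ∫⁻ τ in Ioc 0 t, y τ) := by
        gcongr
        exact ht.2.trans htT
    _ = _ := by ring

/-- A bootstrap argument without continuity. -/
theorem bootstrap_ennreal {y N : ℝ → ENNReal} {T L : ℝ} {a δ B K : ENNReal} (hT : 0 ≤ T)
    (hL : 0 ≤ L) (hB : B ≠ ⊤) (hK : K ≠ ⊤)
    (hyB : ∀ t ∈ Icc 0 T, y t ≤ B)
    (hy : ∀ t ∈ Icc 0 T, y t ≤ a + ∫⁻ τ in Ioc 0 t, N τ)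
    (hNK : ∀ᵐ τ, τ ∈ Icc 0 T → N τ ≤ K)
    (hN : ∀ᵐ τ, τ ∈ Icc 0 T → y τ ≤ 1 → N τ ≤ ENNReal.ofReal L * (y τ + δ))
    (hsmall : 2 * (a + ENNReal.ofReal L * ENNReal.ofReal T * δ) *
      ENNReal.ofReal (Real.exp (2 * L * T)) ≤ 1 / 2) :
    ∀ t ∈ Icc 0 T, y t ≤ 1 := by
  set a' := a + ENNReal.ofReal L * ENNReal.ofReal T * δ with ha'
  -- A time step on which the crude bound N ≤ K contributes at most 1/2. The bound y ≤ 1 advances by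
  -- θ at each induction step, so no continuity of y is used.
  set θ : ℝ := 1 / (2 * (K.toReal + 1)) with hθ
  have hK0 : 0 ≤ K.toReal := ENNReal.toReal_nonneg
  have hθ0 : 0 < θ := by positivity
  have hKθ : K * ENNReal.ofReal θ ≤ 1 / 2 := by
    rw [← ENNReal.ofReal_toReal hK, ← ENNReal.ofReal_mul hK0,
      show (1 / 2 : ENNReal) = ENNReal.ofReal (1 / 2) by
        rw [ENNReal.ofReal_div_of_pos (by norm_num)]; simp]
    apply ENNReal.ofReal_le_ofReal
    rw [hθ, mul_one_div, div_le_div_iff₀ (by positivity) (by norm_num)]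
    nlinarith
  have key : ∀ k : ℕ, ∀ t ∈ Icc 0 T, t ≤ k * θ → y t ≤ 1 := by
    intro k
    induction k with
    | zero =>
      intro t ht htk
      have ht0 : t = 0 := le_antisymm (by simpa using htk) ht.1
      have h1 := hy t ht
      rw [ht0] at h1 ⊢
      simp only [Ioc_self, Measure.restrict_empty, lintegral_zero_measure, add_zero] at h1
      refine h1.trans (le_trans ?_ (hsmall.trans (by
        rw [ENNReal.div_le_iff (by simp) (by simp)]; norm_num)))
      calc a ≤ a' := le_self_add
        _ ≤ 2 * a' := le_mul_of_one_le_left' (by norm_num)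
        _ ≤ _ := le_mul_of_one_le_right' (by
          rw [ENNReal.one_le_ofReal, Real.one_le_exp_iff]; positivity)
    | succ k ih =>
      intro t ht htk
      by_cases hlt : t ≤ k * θ
      · exact ih t ht hlt
      push Not at hlt
      set t₁ : ℝ := k * θ with ht₁
      have ht₁0 : 0 ≤ t₁ := by positivity
      have ht₁T : t₁ ≤ T := hlt.le.trans ht.2
      have hsub : Icc 0 t₁ ⊆ Icc 0 T := Icc_subset_Icc_right ht₁T
      have hN₁ : ∀ᵐ τ, τ ∈ Icc 0 t₁ → N τ ≤ ENNReal.ofReal L * (y τ + δ) := by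
        filter_upwards [hN] with τ h hτ
        exact h (hsub hτ) (ih τ (hsub hτ) hτ.2)
      have hG := gronwall_ennreal_source hL ht₁T hB (fun t ht => hyB t (hsub ht))
        (fun t ht => hy t (hsub ht)) hN₁
      rw [← ha'] at hG
      have h1 : ∫⁻ τ in Ioc 0 t, N τ ≤ (∫⁻ τ in Ioc 0 t₁, N τ) + ∫⁻ τ in Ioc t₁ t, N τ := by
        rw [← Ioc_union_Ioc_eq_Ioc ht₁0 hlt.le]
        exact lintegral_union_le _ _ _
      have h2 : ∫⁻ τ in Ioc t₁ t, N τ ≤ K * ENNReal.ofReal θ := by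
        calc ∫⁻ τ in Ioc t₁ t, N τ ≤ ∫⁻ _ in Ioc t₁ t, K := by
              refine lintegral_mono_ae ?_
              rw [ae_restrict_iff' measurableSet_Ioc]
              filter_upwards [hNK] with τ h hτ
              exact h ⟨ht₁0.trans hτ.1.le, hτ.2.trans ht.2⟩
          _ = K * ENNReal.ofReal (t - t₁) := by simp
          _ ≤ _ := by
              gcongr
              push_cast at htk
              linarith
      -- The whole right-hand side at t₁, and not merely y(t₁), has to be at most 1/2, as it is this
      -- quantity that bounds y at later times. Inserting the Grönwall bound gives a' + a' e^{2Lt₁}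
      -- ≤ 2a' e^{2LT}.
      have h3 : a + ∫⁻ τ in Ioc 0 t₁, N τ ≤ 1 / 2 := by
        have ha't : a' ≠ ⊤ := by
          intro h
          rw [h, ENNReal.mul_top (by simp), ENNReal.top_mul (by simp [Real.exp_pos])] at hsmall
          exact absurd hsmall (by simp)
        refine le_trans ?_ hsmall
        calc a + ∫⁻ τ in Ioc 0 t₁, N τ
            ≤ a + ∫⁻ τ in Ioc 0 t₁, ENNReal.ofReal L *
                (δ + 2 * a' * ENNReal.ofReal (Real.exp (2 * L * τ))) := by
              refine add_le_add le_rfl (lintegral_mono_ae ?_)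
              rw [ae_restrict_iff' measurableSet_Ioc]
              filter_upwards [hN₁] with τ h hτ
              refine (h (Ioc_subset_Icc_self hτ)).trans ?_
              rw [add_comm]
              gcongr
              exact hG τ (Ioc_subset_Icc_self hτ)
          _ = a + (ENNReal.ofReal L * (ENNReal.ofReal t₁ * δ) + 2 * a' * (ENNReal.ofReal L *
                ∫⁻ τ in Ioc 0 t₁, ENNReal.ofReal (Real.exp (2 * L * τ)))) := by
              rw [lintegral_const_mul' _ _ ENNReal.ofReal_ne_top,
                lintegral_add_left measurable_const, lintegral_const_mul' _ _ (by finiteness)]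
              simp only [lintegral_const, Measure.restrict_apply_univ, Real.volume_Ioc, sub_zero]
              ring
          _ ≤ a + (ENNReal.ofReal L * (ENNReal.ofReal T * δ) + 2 * a' *
                (ENNReal.ofReal (Real.exp (2 * L * t₁)) / 2)) := by
              gcongr
              exact lintegral_exp_le hL ht₁0
          _ = a' * 1 + a' * ENNReal.ofReal (Real.exp (2 * L * t₁)) := by
              have : 2 * a' * (ENNReal.ofReal (Real.exp (2 * L * t₁)) / 2)
                  = a' * ENNReal.ofReal (Real.exp (2 * L * t₁)) := by
                rw [mul_comm 2 a', mul_assoc, ENNReal.mul_div_cancel (by simp) (by simp)]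
              rw [this, ha']; ring
          _ ≤ a' * ENNReal.ofReal (Real.exp (2 * L * T)) +
                a' * ENNReal.ofReal (Real.exp (2 * L * T)) := by
              gcongr
              rw [ENNReal.one_le_ofReal, Real.one_le_exp_iff]; positivity
          _ = _ := by ring
      calc y t ≤ a + ∫⁻ τ in Ioc 0 t, N τ := hy t ht
        _ ≤ a + ((∫⁻ τ in Ioc 0 t₁, N τ) + K * ENNReal.ofReal θ) := by
            gcongr; exact h1.trans (by gcongr)
        _ = (a + ∫⁻ τ in Ioc 0 t₁, N τ) + K * ENNReal.ofReal θ := by rw [add_assoc]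
        _ ≤ 1 / 2 + 1 / 2 := by gcongr
        _ = 1 := ENNReal.add_halves 1
  intro t ht
  obtain ⟨k, hk⟩ := exists_nat_ge (T / θ)
  exact key k t ht (ht.2.trans ((div_le_iff₀ hθ0).1 hk))

/-! ### Sobolev bounds along Duhamel's formula. -/

theorem duhamel_zero {P : Space d → ℝ} (hP : Measurable P) {T : ℝ} (hT : 0 ≤ T) {u₀ : L2 d}
    {N : (Space d → ℂ) → Space d → ℂ} {u : ℝ → L2 d} (hu : IsSolution P N T u₀ u) : u 0 = u₀ := by
  obtain ⟨-, F, -, -, h⟩ := hu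
  rw [h 0 ⟨le_rfl, hT⟩]
  simp [propagator_zero hP]

theorem continuous_wNorm_truncWeight (s : ℝ) (n : ℕ) :
    Continuous fun f : L2 d => wNorm (truncWeight s n) f := by
  obtain ⟨A, hA⟩ := exists_clm_enorm_eq_wNorm (measurable_truncWeight (d := d) s n) (truncWeight_le s n)
  simp only [← hA]
  exact A.continuous.enorm

/-- An `L^∞ H^s` bound of a function that is continuous in `L²` holds at all times. -/
theorem wNorm_le_supSobolevENorm {T s : ℝ} (hT : 0 < T) {u : ℝ → L2 d}
    (hu : ContinuousOn u (Icc 0 T)) :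
    ∀ t ∈ Icc 0 T, wNorm (weight s) (u t) ≤ supSobolevENorm T s u := by
  intro t ht
  rw [wNorm_weight_eq_iSup]
  refine iSup_le fun n => ?_
  have hc : ContinuousOn (fun t => wNorm (truncWeight s n) (u t)) (Icc 0 T) :=
    (continuous_wNorm_truncWeight s n).comp_continuousOn hu
  -- The truncated norm is continuous in time. Written as the equality max(·, sup) = sup of
  -- continuous functions, the almost everywhere bound extends to all of [0,T].
  have hae : (fun t => max (wNorm (truncWeight s n) (u t)) (supSobolevENorm T s u))
      =ᵐ[volume.restrict (Icc 0 T)] fun _ => supSobolevENorm T s u := by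
    filter_upwards [ENNReal.ae_le_essSup (μ := volume.restrict (Icc 0 T))
      (fun t => sobolevENorm s (u t))] with t h
    refine max_eq_right ((wNorm_mono (truncWeight_le_weight s n) _).trans ?_)
    rw [← sobolevENorm_eq_wNorm]
    exact h
  have := Measure.eqOn_Icc_of_ae_eq volume hT.ne hae (hc.sup continuousOn_const)
    continuousOn_const ht
  exact max_eq_right_iff.1 this

theorem supSobolevENorm_le {T s : ℝ} {w : ℝ → L2 d} {M : ENNReal}
    (h : ∀ t ∈ Icc 0 T, wNorm (weight s) (w t) ≤ M) : supSobolevENorm T s w ≤ M := by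
  refine essSup_le_of_ae_le M ?_
  filter_upwards [ae_restrict_mem measurableSet_Icc] with t ht
  rw [sobolevENorm_eq_wNorm]
  exact h t ht

/-- Comparison of two Duhamel formulas with different groups. -/
theorem wNorm_sub_duhamel_le {P Q : Space d → ℝ} (hP : Measurable P) (hQ : Measurable Q)
    {s γ c T : ℝ} (hc : 0 ≤ c) (hPQ : ∀ ξ, |Q ξ - P ξ| ≤ c * japaneseBracket ξ ^ γ)
    {u₀ : L2 d} {u v F G : ℝ → L2 d} (hF : IntegrableOn F (Icc 0 T) volume)
    (hG : IntegrableOn G (Icc 0 T) volume)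
    (hu : ∀ t ∈ Icc (0 : ℝ) T,
      u t = propagator Q t u₀ - Complex.I • ∫ τ in (0 : ℝ)..t, propagator Q (t - τ) (F τ))
    (hv : ∀ t ∈ Icc (0 : ℝ) T,
      v t = propagator P t u₀ - Complex.I • ∫ τ in (0 : ℝ)..t, propagator P (t - τ) (G τ))
    {M M₁ : ENNReal} (hM : wNorm (weight (s + γ)) u₀ ≤ M)
    (hM₁ : ∀ᵐ τ, τ ∈ Icc 0 T → wNorm (weight (s + γ)) (F τ) ≤ M₁) :
    ∀ t ∈ Icc 0 T, wNorm (weight s) (u t - v t) ≤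
      ENNReal.ofReal (T * c) * (M + ENNReal.ofReal T * M₁)
        + ∫⁻ τ in Ioc 0 t, wNorm (weight s) (F τ - G τ) := by
  intro t ht
  have hsub : Ioc 0 t ⊆ Icc 0 T := Ioc_subset_Icc_self.trans (Icc_subset_Icc_right ht.2)
  have hint : ∀ {R : Space d → ℝ} {H : ℝ → L2 d}, Measurable R → IntegrableOn H (Icc 0 T) volume →
      IntervalIntegrable (fun τ => propagator R (t - τ) (H τ)) volume 0 t := fun hR hH => by
    rw [intervalIntegrable_iff_integrableOn_Ioc_of_le ht.1]
    exact (integrableOn_propagator hR hH (continuous_const.sub continuous_id)).mono_set hsub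
  have hlin : ∀ τ, propagator P (t - τ) (F τ) - propagator P (t - τ) (G τ)
      = propagator P (t - τ) (F τ - G τ) := fun τ =>
    ((propagatorIsometry hP (t - τ)).map_sub (F τ) (G τ)).symm
  -- The term S_P(F) is inserted, so the difference of groups acts only on u₀ and F, and G is needed
  -- only in H^s.
  have e : u t - v t = (propagator Q t u₀ - propagator P t u₀) - Complex.I •
      ((∫ τ in (0 : ℝ)..t, (propagator Q (t - τ) (F τ) - propagator P (t - τ) (F τ))) +
        ∫ τ in (0 : ℝ)..t, propagator P (t - τ) (F τ - G τ)) := by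
    rw [intervalIntegral.integral_sub (hint hQ hF) (hint hP hF), ← intervalIntegral.integral_congr
      (fun τ _ => hlin τ), intervalIntegral.integral_sub (hint hP hF) (hint hP hG),
      hu t ht, hv t ht, sub_add_sub_cancel, smul_sub]
    abel
  have hmul : ∀ τ ∈ Icc 0 t, ∀ f : L2 d, wNorm (weight s) (propagator Q τ f - propagator P τ f)
      ≤ ENNReal.ofReal (T * c) * wNorm (weight (s + γ)) f := fun τ hτ f => by
    refine (wNorm_propagator_sub_le hQ hP hc hPQ τ f).trans ?_
    gcongr
    rw [abs_of_nonneg hτ.1]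
    exact hτ.2.trans ht.2
  rw [e]
  refine (wNorm_sub_le (measurable_weight s) _ _).trans ?_
  rw [wNorm_smul _ _ (by rw [← ofReal_norm]; simp), mul_add, add_assoc]
  refine add_le_add ((hmul t ⟨ht.1, le_rfl⟩ u₀).trans (by gcongr)) ?_
  refine (wNorm_add_le (measurable_weight s) _ _).trans (add_le_add ?_ ?_)
  · refine (wNorm_integral_le s _ ht.1).trans ?_
    calc _ ≤ ∫⁻ _ in Ioc 0 t, ENNReal.ofReal (T * c) * M₁ := by
          refine lintegral_mono_ae ?_
          rw [ae_restrict_iff' measurableSet_Ioc]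
          filter_upwards [hM₁] with τ h hτ
          refine (hmul (t - τ) ⟨by linarith [hτ.2], by linarith [hτ.1]⟩ (F τ)).trans ?_
          gcongr
          exact h (hsub hτ)
      _ = ENNReal.ofReal (T * c) * M₁ * ENNReal.ofReal t := by simp
      _ ≤ ENNReal.ofReal (T * c) * M₁ * ENNReal.ofReal T := by gcongr; exact ht.2
      _ = _ := by ring
  · refine (wNorm_integral_le s _ ht.1).trans (le_of_eq ?_)
    simp only [wNorm_propagator hP]

theorem wNorm_duhamel_le {P : Space d → ℝ} (hP : Measurable P) {s T : ℝ} {u₀ : L2 d}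
    {v G : ℝ → L2 d}
    (hv : ∀ t ∈ Icc (0 : ℝ) T,
      v t = propagator P t u₀ - Complex.I • ∫ τ in (0 : ℝ)..t, propagator P (t - τ) (G τ)) :
    ∀ t ∈ Icc 0 T, wNorm (weight s) (v t) ≤ wNorm (weight s) u₀
      + ∫⁻ τ in Ioc 0 t, wNorm (weight s) (G τ) := by
  intro t ht
  rw [hv t ht]
  refine (wNorm_sub_le (measurable_weight s) _ _).trans ?_
  rw [wNorm_smul _ _ (by rw [← ofReal_norm]; simp), wNorm_propagator hP]
  refine add_le_add le_rfl ((wNorm_integral_le s _ ht.1).trans (le_of_eq ?_))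
  simp only [wNorm_propagator hP]

theorem wNorm_trunc_duhamel_le {P : Space d → ℝ} (hP : Measurable P) {s T : ℝ} (n : ℕ) {u₀ : L2 d}
    {v G : ℝ → L2 d}
    (hv : ∀ t ∈ Icc (0 : ℝ) T,
      v t = propagator P t u₀ - Complex.I • ∫ τ in (0 : ℝ)..t, propagator P (t - τ) (G τ)) :
    ∀ t ∈ Icc 0 T, wNorm (truncWeight s n) (v t) ≤ wNorm (truncWeight s n) u₀
      + ∫⁻ τ in Ioc 0 t, wNorm (truncWeight s n) (G τ) := by
  intro t ht
  rw [hv t ht]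
  refine (wNorm_sub_le (measurable_truncWeight s n) _ _).trans ?_
  rw [wNorm_smul _ _ (by rw [← ofReal_norm]; simp), wNorm_propagator hP]
  refine add_le_add le_rfl ((wNorm_trunc_integral_le s n _ ht.1).trans (le_of_eq ?_))
  simp only [wNorm_propagator hP]

/-! ### Bounds of v in H^s. -/

/-- Persistence of `H^s` regularity for the saturated equation, with a bound that depends on
the cut-off. -/
theorem wNorm_saturated_le {P : Space d → ℝ} (hP : Measurable P) {s T : ℝ} (hs : 0 ≤ s)
    {ε : ℝ} (hε : ε = 1 ∨ ε = -1) (σ : ℕ) {χ : Space d → ℝ} (hχm : Measurable χ)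
    (hχ : ∀ ξ, χ (-ξ) = χ ξ) {Λ : ENNReal} (hΛ : Λ ≠ ⊤)
    (hχi : ∫⁻ η : Space d, ENNReal.ofReal (2 ^ (s + 1)) * weight s η *
      ‖χ ((2 * Real.pi) • η)‖ₑ ≤ Λ)
    {u₀ : L2 d} {v : ℝ → L2 d} (hv : IsSolution P (saturatedNonlinearity ε σ χ) T u₀ v) :
    ∀ t ∈ Icc 0 T, wNorm (weight s) (v t) ≤ 2 * wNorm (weight s) u₀ *
      ENNReal.ofReal (Real.exp (2 * ((Λ * ‖u₀‖ₑ ^ 2) ^ σ).toReal * T)) := by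
  obtain ⟨hvc, G, hGi, hG, hd⟩ := hv
  set κ : Space d → ENNReal := fun η => ENNReal.ofReal (2 ^ (s + 1)) * weight s η with hκ
  have hκm : Measurable κ := by fun_prop
  have hκ1 : ∀ x, 1 ≤ κ x := fun x =>
    one_le_mul (by
      rw [ENNReal.one_le_ofReal]; exact Real.one_le_rpow (by norm_num) (by linarith))
      (one_le_weight hs x)
  have hχt := ne_top_of_le_ne_top hΛ hχi
  -- Used with w = 1 for the L² bound of the nonlinearity required by mass conservation, then with
  -- the truncated weights.
  have hGw : ∀ {w : Space d → ENNReal}, Measurable w → (∀ x y, w (x + y) ≤ κ x * w y) →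
      ∀ᵐ τ ∂(volume.restrict (Icc (0 : ℝ) T)),
        wNorm w (G τ) ≤ (Λ * ‖v τ‖ₑ ^ 2) ^ σ * wNorm w (v τ) := fun hw hwκ => by
    filter_upwards [hG] with τ h
    refine (wNorm_saturatedNonlinearity_le hε σ hχm hw hκm hκ1 hwκ hχt h).trans ?_
    gcongr
  obtain ⟨R, hR⟩ := isCompact_Icc.exists_bound_of_continuousOn hvc
  have hRe : ∀ t ∈ Icc 0 T, ‖v t‖ₑ ≤ ENNReal.ofReal R := fun t ht => by
    rw [← ofReal_norm]; exact ENNReal.ofReal_le_ofReal (hR t ht)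
  have hmass : ∀ t ∈ Icc 0 T, ‖v t‖ = ‖u₀‖ := by
    refine norm_eq_of_duhamel hP hGi
      (K := ((Λ * ENNReal.ofReal R ^ 2) ^ σ * ENNReal.ofReal R).toReal) ?_ ?_ hd
    · filter_upwards [hGw (w := 1) measurable_one (fun x y => by simpa using hκ1 x),
        ae_restrict_mem measurableSet_Icc] with τ h hτ
      rw [wNorm_one, wNorm_one] at h
      rw [← toReal_enorm]
      refine ENNReal.toReal_mono (by finiteness) (h.trans ?_)
      have := hRe τ hτ
      gcongr
    · filter_upwards [hG] with τ h
      exact inner_saturatedNonlinearity_im hχ h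
  intro t ht
  rw [wNorm_weight_eq_iSup]
  refine iSup_le fun n => ?_
  -- Mass conservation replaces ‖v(τ)‖ by ‖u₀‖, so the inequality is linear with a constant
  -- independent of n. The bound n‖u₀‖ only provides the finiteness that Grönwall requires.
  set L := ((Λ * ‖u₀‖ₑ ^ 2) ^ σ).toReal with hL
  have hLe : ENNReal.ofReal L = (Λ * ‖u₀‖ₑ ^ 2) ^ σ := ENNReal.ofReal_toReal (by finiteness)
  have hgr := gronwall_ennreal (y := fun t => wNorm (truncWeight s n) (v t)) (t₀ := T) (L := L)
    (a := wNorm (truncWeight s n) u₀) (B := n * ‖u₀‖ₑ) ENNReal.toReal_nonneg (by finiteness)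
    (fun t ht => (wNorm_truncWeight_le s n (v t)).trans (by
      rw [← ofReal_norm, hmass t ht, ofReal_norm])) (fun t ht => by
      refine (wNorm_trunc_duhamel_le hP n hd t ht).trans (add_le_add le_rfl ?_)
      rw [← lintegral_const_mul' _ _ ENNReal.ofReal_ne_top, hLe]
      refine lintegral_mono_ae ?_
      have h1 := hGw (measurable_truncWeight s n) (fun x y => truncWeight_add_le hs n x y)
      rw [ae_restrict_iff' measurableSet_Icc] at h1
      rw [ae_restrict_iff' measurableSet_Ioc]
      filter_upwards [h1] with τ h hτ
      have hτ' : τ ∈ Icc 0 T := ⟨hτ.1.le, hτ.2.trans ht.2⟩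
      have := h hτ'
      rwa [← ofReal_norm, hmass τ hτ', ofReal_norm] at this) t ht
  refine hgr.trans ?_
  have h1 : wNorm (truncWeight s n) u₀ ≤ ⨆ n, wNorm (truncWeight s n) u₀ :=
    le_iSup (fun n => wNorm (truncWeight s n) u₀) n
  have h2 : L * t ≤ L * T := mul_le_mul_of_nonneg_left ht.2 ENNReal.toReal_nonneg
  rw [← wNorm_weight_eq_iSup] at h1
  gcongr ?_ * ENNReal.ofReal (Real.exp ?_)
  · gcongr
  · linarith

/-- Propagation of `H^s` regularity, uniformly in the cut-off, from a bound in `H^r`. -/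
theorem exists_wNorm_saturated_le_of_low {r s T : ℝ} (hr : (d : ℝ) / 2 < r) (hrs : r ≤ s)
    {ε : ℝ} (hε : ε = 1 ∨ ε = -1) (σ : ℕ) {A : ENNReal} (hA : A ≠ ⊤) {u₀ : L2 d}
    (hu₀ : wNorm (weight s) u₀ ≠ ⊤) : ∃ R : ENNReal, R ≠ ⊤ ∧
    ∀ (P : Space d → ℝ) (χ : Space d → ℝ), Measurable P → Measurable χ →
      (∀ ξ, χ ξ ∈ Icc (0 : ℝ) 1) → ∀ v : ℝ → L2 d,
      IsSolution P (saturatedNonlinearity ε σ χ) T u₀ v →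
      (∃ B : ENNReal, B ≠ ⊤ ∧ ∀ t ∈ Icc 0 T, wNorm (weight s) (v t) ≤ B) →
      (∀ t ∈ Icc 0 T, wNorm (weight r) (v t) ≤ A) →
      ∀ t ∈ Icc 0 T, wNorm (weight s) (v t) ≤ R := by
  obtain ⟨C, hC, h⟩ := exists_hsBdd_saturatedNonlinearity_tame hr hrs hε σ hA
  refine ⟨2 * wNorm (weight s) u₀ * ENNReal.ofReal (Real.exp (2 * C.toReal * T)), by finiteness,
    fun P χ hP hχm hχ v ⟨hvc, G, hGi, hG, hd⟩ ⟨B, hB, hvB⟩ hvA t ht => ?_⟩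
  -- B may depend on the solution and on χ: it is used only through its finiteness and does not
  -- enter the resulting bound.
  have hgr := gronwall_ennreal (y := fun t => wNorm (weight s) (v t)) (t₀ := T) (L := C.toReal)
    (a := wNorm (weight s) u₀) ENNReal.toReal_nonneg hB hvB (fun t ht => by
      refine (wNorm_duhamel_le hP hd t ht).trans (add_le_add le_rfl ?_)
      rw [← lintegral_const_mul' _ _ ENNReal.ofReal_ne_top, ENNReal.ofReal_toReal hC]
      refine lintegral_mono_ae ?_
      rw [ae_restrict_iff' measurableSet_Icc] at hG
      rw [ae_restrict_iff' measurableSet_Ioc]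
      filter_upwards [hG] with τ e hτ
      have hτ' : τ ∈ Icc 0 T := ⟨hτ.1.le, hτ.2.trans ht.2⟩
      exact (h χ hχm hχ (v τ) _ (ne_top_of_le_ne_top hB (hvB τ hτ'))
        ((hsBdd_coeFn r (v τ)).mono (hvA τ hτ')) (hsBdd_coeFn s (v τ))).wNorm_le (e hτ')) t ht
  refine hgr.trans ?_
  have h2 : C.toReal * t ≤ C.toReal * T := mul_le_mul_of_nonneg_left ht.2 ENNReal.toReal_nonneg
  gcongr 2 * wNorm (weight s) u₀ * ENNReal.ofReal (Real.exp ?_)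
  linarith

/-! ### Scaled cut-offs and small parameters. -/

/-- The left side vanishes for |hξ| < 1, and otherwise h⟨ξ⟩ ≥ 1. -/
theorem one_sub_cutoff_le {χ : Space d → ℝ} (hχ01 : ∀ ξ, χ ξ ∈ Icc (0 : ℝ) 1)
    (hχone : ∀ ξ ∈ Metric.ball (0 : Space d) 1, χ ξ = 1) {γ h : ℝ} (hγ : 0 ≤ γ) (hh : 0 < h)
    (ξ : Space d) : 1 - χ (h • ξ) ≤ h ^ γ * japaneseBracket ξ ^ γ := by
  have hJ := japaneseBracket_pos ξ
  by_cases hξ : h • ξ ∈ Metric.ball (0 : Space d) 1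
  · rw [hχone _ hξ, sub_self]
    positivity
  · rw [Metric.mem_ball, dist_zero_right, not_lt, norm_smul, Real.norm_of_nonneg hh.le] at hξ
    rw [← Real.mul_rpow hh.le hJ.le]
    have h1 : 1 ≤ h * japaneseBracket ξ :=
      hξ.trans (mul_le_mul_of_nonneg_left (norm_le_japaneseBracket ξ) hh.le)
    linarith [Real.one_le_rpow h1 hγ, (hχ01 (h • ξ)).1]

theorem lintegral_weight_ne_top {q : ℝ} (hq : (d : ℝ) < q) :
    ∫⁻ η : Space d, weight (-q) η ≠ ⊤ := by
  have h := ENNReal.pow_ne_top (n := 2) (eLpNorm_weight_neg_ne_top (d := d) (s := q / 2) (by linarith))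
  rw [eLpNorm_two_sq] at h
  convert h using 3 with η
  rw [sq, ← weight_add_exponent]
  congr 1; ring

/-- Integrability of a scaled Schwartz cut-off, uniformly away from the scale zero. -/
theorem exists_lintegral_schwartz_le (χ : SchwartzMap (Space d) ℝ) {s h₀ : ℝ} (hh₀ : 0 < h₀) :
    ∃ Λ : ENNReal, Λ ≠ ⊤ ∧ ∀ h ∈ Icc h₀ 1,
      ∫⁻ η : Space d, ENNReal.ofReal (2 ^ (s + 1)) * weight s η *
        ‖χ (h • ((2 * Real.pi) • η))‖ₑ ≤ Λ := by
  -- Decay of order k > s + d makes ⟨ξ⟩^{s-k} integrable; the bound h ≥ h₀ costs only the factor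
  -- h₀^{-k}.
  obtain ⟨k, hk⟩ := exists_nat_gt (s + d)
  set c := 2 ^ k * (Finset.Iic (k, 0)).sup (fun m => SchwartzMap.seminorm ℝ m.1 m.2) χ with hc
  have hdecay : ∀ ξ : Space d, (1 + ‖ξ‖) ^ k * ‖χ ξ‖ ≤ c := fun ξ => by
    simpa using SchwartzMap.one_add_le_sup_seminorm_apply (𝕜 := ℝ) (m := (k, 0)) le_rfl le_rfl χ ξ
  have hc0 : 0 ≤ c := le_trans (by positivity) (hdecay 0)
  refine ⟨ENNReal.ofReal (2 ^ (s + 1)) * ENNReal.ofReal (c * (h₀ ^ k)⁻¹) *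
    ∫⁻ η : Space d, weight (-(k - s)) η, ?_, fun h hh => ?_⟩
  · have := lintegral_weight_ne_top (d := d) (q := k - s) (by linarith)
    finiteness
  rw [← lintegral_const_mul' _ _ (by finiteness)]
  refine lintegral_mono fun η => ?_
  have hη : -((k : ℝ) - s) = s + -(k : ℝ) := by ring
  rw [hη, weight_add_exponent]
  set ξ : Space d := (2 * Real.pi) • η with hξ
  have hJ := japaneseBracket_pos ξ
  have h1 : ‖χ (h • ξ)‖ ≤ c * (h₀ ^ k)⁻¹ * japaneseBracket ξ ^ (-(k : ℝ)) := by
    have h2 : h₀ * japaneseBracket ξ ≤ 1 + ‖h • ξ‖ := by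
      rw [norm_smul, Real.norm_of_nonneg (hh₀.le.trans hh.1)]
      have h3 : japaneseBracket ξ ≤ 1 + ‖ξ‖ :=
        le_of_sq_le_sq (by rw [japaneseBracket_sq]; nlinarith [norm_nonneg ξ]) (by positivity)
      calc h₀ * japaneseBracket ξ ≤ h₀ * (1 + ‖ξ‖) := by gcongr
        _ = h₀ + h₀ * ‖ξ‖ := by ring
        _ ≤ 1 + h * ‖ξ‖ := by
          have := hh.1; have := hh.2
          gcongr; linarith
    rw [Real.rpow_neg hJ.le, Real.rpow_natCast, mul_assoc, ← mul_inv, ← mul_pow,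
      ← div_eq_mul_inv, le_div_iff₀ (by positivity), mul_comm]
    refine le_trans ?_ (hdecay (h • ξ))
    gcongr
  have h4 : ‖χ (h • ξ)‖ₑ ≤ ENNReal.ofReal (c * (h₀ ^ k)⁻¹) * weight (-(k : ℝ)) η := by
    rw [weight, ← ENNReal.ofReal_mul (by positivity), ← ofReal_norm]
    exact ENNReal.ofReal_le_ofReal h1
  calc _ ≤ ENNReal.ofReal (2 ^ (s + 1)) * weight s η *
        (ENNReal.ofReal (c * (h₀ ^ k)⁻¹) * weight (-(k : ℝ)) η) := by gcongr
    _ = _ := by ring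

/-- The Lipschitz estimate between the two nonlinearities, for elements of `L²`. -/
theorem exists_wNorm_nonlinearity_sub_le {s β : ℝ} (hs : (d : ℝ) / 2 < s) (hβ : 0 ≤ β) {ε : ℝ}
    (hε : ε = 1 ∨ ε = -1) (σ : ℕ) {A : ENNReal} (hA : A ≠ ⊤) : ∃ L : ℝ, 0 ≤ L ∧
    ∀ (χ : Space d → ℝ), Measurable χ → (∀ ξ, χ ξ ∈ Icc (0 : ℝ) 1) → ∀ δ : ℝ, 0 ≤ δ →
      (∀ ξ, 1 - χ ξ ≤ δ * japaneseBracket ξ ^ β) → ∀ u v F G : L2 d,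
      (F : Space d → ℂ) =ᵐ[volume] powerNonlinearity ε σ u →
      (G : Space d → ℂ) =ᵐ[volume] saturatedNonlinearity ε σ χ v →
      wNorm (weight (s + β)) u ≤ A → wNorm (weight s) v ≤ A →
      wNorm (weight s) (F - G)
        ≤ ENNReal.ofReal L * (wNorm (weight s) (u - v) + ENNReal.ofReal δ) := by
  obtain ⟨C, hC, h⟩ := exists_hsBdd_nonlinearity_sub hs hβ hε σ hA
  refine ⟨C.toReal, ENNReal.toReal_nonneg, fun χ hχm hχ δ hδ hχδ u v F G hF hG hu hv => ?_⟩
  rw [ENNReal.ofReal_toReal hC]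
  have hu' : wNorm (weight s) u ≤ A :=
    (wNorm_mono (weight_mono (le_add_of_nonneg_right hβ)) u).trans hu
  have huv : wNorm (weight s) (u - v) ≠ ⊤ :=
    ne_top_of_le_ne_top (ENNReal.add_ne_top.2 ⟨hA, hA⟩)
      ((wNorm_sub_le (measurable_weight s) u v).trans (add_le_add hu' hv))
  refine (h χ hχm hχ δ hδ hχδ u v _ huv ((hsBdd_coeFn _ u).mono hu) ((hsBdd_coeFn _ v).mono hv)
    ((hsBdd_coeFn s (u - v)).congr (Lp.coeFn_sub u v))).wNorm_le ?_
  filter_upwards [Lp.coeFn_sub F G, hF, hG] with x e1 e2 e3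
  rw [e1, Pi.sub_apply, e2, e3]

theorem exists_forall_mul_rpow_le {Z : ENNReal} (hZ : Z ≠ ⊤) {m : ℝ} (hm : 0 < m) :
    ∃ h₀ ∈ Ioc (0 : ℝ) 1, ∀ h ∈ Ioo 0 h₀, Z * ENNReal.ofReal (h ^ m) ≤ 1 / 2 := by
  have h1 : Tendsto (fun h : ℝ => Z * ENNReal.ofReal (h ^ m)) (𝓝[>] 0) (𝓝 0) := by
    have h2 : Tendsto (fun h : ℝ => h ^ m) (𝓝[>] 0) (𝓝 0) := by
      have := (Real.continuousAt_rpow_const 0 m (Or.inr hm.le)).tendsto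
      rw [Real.zero_rpow hm.ne'] at this
      exact this.mono_left nhdsWithin_le_nhds
    have h3 := ENNReal.Tendsto.const_mul (a := Z) (ENNReal.tendsto_ofReal h2) (Or.inr hZ)
    simpa using h3
  have h4 : ∀ᶠ h : ℝ in 𝓝[>] 0, Z * ENNReal.ofReal (h ^ m) < 1 / 2 :=
    h1.eventually_lt_const (by simp)
  obtain ⟨a, ha, h5⟩ := mem_nhdsGT_iff_exists_Ioo_subset.1 h4
  refine ⟨min a 1, ⟨lt_min ha zero_lt_one, min_le_right _ _⟩, fun h hh => ?_⟩
  exact (h5 ⟨hh.1, hh.2.trans_le (min_le_left _ _)⟩ : _ < _).le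

/-- Puts the constant produced by Grönwall into the form Z h^{min(α,ρ)}; as h ≤ 1, the smaller
exponent dominates. -/
theorem error_le {c α ρ h : ℝ} (hc : 0 ≤ c) (hh : h ∈ Ioc (0 : ℝ) 1) (D E X : ENNReal) :
    2 * (ENNReal.ofReal (c * h ^ α) * D + E * ENNReal.ofReal (h ^ ρ)) * X
      ≤ 2 * (ENNReal.ofReal c * D + E) * X * ENNReal.ofReal (h ^ min α ρ) := by
  have h1 : ENNReal.ofReal (h ^ α) ≤ ENNReal.ofReal (h ^ min α ρ) :=
    ENNReal.ofReal_le_ofReal (Real.rpow_le_rpow_of_exponent_ge hh.1 hh.2 (min_le_left _ _))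
  have h2 : ENNReal.ofReal (h ^ ρ) ≤ ENNReal.ofReal (h ^ min α ρ) :=
    ENNReal.ofReal_le_ofReal (Real.rpow_le_rpow_of_exponent_ge hh.1 hh.2 (min_le_right _ _))
  rw [ENNReal.ofReal_mul hc]
  calc _ ≤ 2 * (ENNReal.ofReal c * ENNReal.ofReal (h ^ min α ρ) * D +
        E * ENNReal.ofReal (h ^ min α ρ)) * X := by gcongr
    _ = _ := by ring

end SaturatedNLS

end

/-! ### The convergence estimate. -/

theorem mainTheorem3 (d : ℕ) (hd : 1 ≤ d) (σ : ℕ) (ε : ℝ) (hε : ε = 1 ∨ ε = -1)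
    (α β : ℝ) (hα : 0 < α) (hβ : 0 ≤ β)
    (P : ℝ → SaturatedNLS.Space d → ℝ)
    (hPmeas : ∀ h ∈ Set.Ioc (0 : ℝ) 1, Measurable (P h))
    (hP : ∃ C₀ : ℝ, ∀ h ∈ Set.Ioc (0 : ℝ) 1, ∀ ξ : SaturatedNLS.Space d,
      |P h ξ - (-‖ξ‖ ^ 2)| ≤ C₀ * (h ^ α * SaturatedNLS.japaneseBracket ξ ^ β))
    (χ : SchwartzMap (SaturatedNLS.Space d) ℝ)
    (hχ01 : ∀ ξ, χ ξ ∈ Set.Icc (0 : ℝ) 1)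
    (hχeven : ∀ ξ, χ (-ξ) = χ ξ)
    (hχone : ∀ ξ ∈ Metric.ball (0 : SaturatedNLS.Space d) 1, χ ξ = 1)
    (s : ℝ) (hs : (d : ℝ) / 2 < s) (T : ℝ) (hT : 0 < T)
    (u₀ : SaturatedNLS.L2 d) (u : ℝ → SaturatedNLS.L2 d)
    (hu : SaturatedNLS.IsSolution (fun ξ => -‖ξ‖ ^ 2)
      (SaturatedNLS.powerNonlinearity ε σ) T u₀ u)
    (hureg : SaturatedNLS.supSobolevENorm T (s + β) u < ⊤) :
    ∃ C : ℝ, ∀ h ∈ Set.Ioc (0 : ℝ) 1, ∀ v : ℝ → SaturatedNLS.L2 d,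
      SaturatedNLS.IsSolution (P h)
        (SaturatedNLS.saturatedNonlinearity ε σ (fun ξ => χ (h • ξ))) T u₀ v →
      SaturatedNLS.supSobolevENorm T s (fun t => u t - v t)
        ≤ ENNReal.ofReal (C * h ^ min α β) := by
  open SaturatedNLS in
  obtain ⟨C₀, hC₀⟩ := hP
  have hQ : Measurable fun ξ : Space d => -‖ξ‖ ^ 2 := by fun_prop
  have hs0 : 0 ≤ s := le_trans (by positivity) hs.le
  have hsβ : (d : ℝ) / 2 < s + β := hs.trans_le (le_add_of_nonneg_right hβ)
  -- bounds for `u` and its nonlinearity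
  have hu0 := duhamel_zero hQ hT.le hu
  obtain ⟨huc, F, hFi, hF, hud⟩ := hu
  rw [ae_restrict_iff' measurableSet_Icc] at hF
  set M := supSobolevENorm T (s + β) u with hMdef
  have hMt : M ≠ ⊤ := hureg.ne
  have hM : ∀ t ∈ Icc 0 T, wNorm (weight (s + β)) (u t) ≤ M := wNorm_le_supSobolevENorm hT huc
  have hM0 : wNorm (weight (s + β)) u₀ ≤ M := hu0 ▸ hM 0 ⟨le_rfl, hT.le⟩
  have hMs : ∀ q ≤ s + β, ∀ t ∈ Icc 0 T, wNorm (weight q) (u t) ≤ M := fun q hq t ht =>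
    (wNorm_mono (weight_mono hq) _).trans (hM t ht)
  have hM0s : wNorm (weight s) u₀ ≠ ⊤ := ne_top_of_le_ne_top hMt
    ((wNorm_mono (weight_mono (le_add_of_nonneg_right hβ)) _).trans hM0)
  obtain ⟨M₁, hM₁t, hM₁⟩ : ∃ M₁ : ENNReal, M₁ ≠ ⊤ ∧
      ∀ᵐ τ, τ ∈ Icc 0 T → wNorm (weight (s + β)) (F τ) ≤ M₁ := by
    obtain ⟨C, hC, h⟩ := exists_hsBdd_powerNonlinearity (d := d) hsβ hε σ hMt
    refine ⟨C, hC, ?_⟩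
    filter_upwards [hF] with τ e hτ
    exact (h (u τ) ((hsBdd_coeFn _ _).mono (hM τ hτ))).wNorm_le (e hτ)
  -- the cut-off
  have hχm : ∀ h : ℝ, Measurable fun ξ : Space d => χ (h • ξ) := fun h =>
    (χ.continuous.comp (continuous_const_smul h)).measurable
  have hχh : ∀ (h : ℝ) (ξ : Space d), χ (h • ξ) ∈ Icc (0 : ℝ) 1 := fun h ξ => hχ01 _
  have hχe : ∀ (h : ℝ) (ξ : Space d), χ (h • -ξ) = χ (h • ξ) := fun h ξ => by
    rw [smul_neg, hχeven]
  -- the Duhamel comparison, in `H^q` with `q + ρ = s + β`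
  have hdiff : ∀ q ρ : ℝ, q + ρ = s + β → β ≤ ρ → ∀ h ∈ Ioc (0 : ℝ) 1, ∀ v G : ℝ → L2 d,
      IntegrableOn G (Icc 0 T) volume →
      (∀ t ∈ Icc (0 : ℝ) T, v t = propagator (P h) t u₀ -
        Complex.I • ∫ τ in (0 : ℝ)..t, propagator (P h) (t - τ) (G τ)) →
      ∀ t ∈ Icc 0 T, wNorm (weight q) (u t - v t) ≤
        ENNReal.ofReal (T * |C₀| * h ^ α) * (M + ENNReal.ofReal T * M₁)
          + ∫⁻ τ in Ioc 0 t, wNorm (weight q) (F τ - G τ) := by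
    intro q ρ hqρ hρ h hh v G hG hv
    have hhα : 0 ≤ h ^ α := Real.rpow_nonneg hh.1.le α
    rw [mul_assoc T]
    -- The symbol bound is weakened from ⟨ξ⟩^β to ⟨ξ⟩^ρ, which is affordable because u₀ and F have q
    -- + ρ = s + β derivatives.
    refine wNorm_sub_duhamel_le (hPmeas h hh) hQ (γ := ρ) (by positivity) (fun ξ => ?_) hFi hG
      hud hv (by rwa [hqρ]) (by rwa [hqρ])
    rw [abs_sub_comm]
    refine (hC₀ h hh ξ).trans ?_
    rw [← mul_assoc]
    have := japaneseBracket_pos ξ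
    gcongr
    · exact le_abs_self _
    · exact one_le_japaneseBracket ξ
  set D : ENNReal := M + ENNReal.ofReal T * M₁ with hD
  have hDt : D ≠ ⊤ := by finiteness
  -- persistence of regularity
  have hpers : ∀ h₀ : ℝ, 0 < h₀ → ∃ B : ENNReal, B ≠ ⊤ ∧ ∀ h ∈ Ioc (0 : ℝ) 1, h₀ ≤ h →
      ∀ v : ℝ → L2 d, IsSolution (P h) (saturatedNonlinearity ε σ (fun ξ => χ (h • ξ))) T u₀ v →
      ∀ t ∈ Icc 0 T, wNorm (weight s) (v t) ≤ B := by
    intro h₀ hh₀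
    obtain ⟨Λ, hΛ, hΛb⟩ := exists_lintegral_schwartz_le χ (s := s) hh₀
    exact ⟨_, by finiteness, fun h hh hhh₀ v hv => wNorm_saturated_le (hPmeas h hh) hs0 hε σ
      (hχm h) (hχe h) hΛ (hΛb h ⟨hhh₀, hh.2⟩) hv⟩
  -- a uniform bound in a lower norm, for small `h`
  set r : ℝ := (s + d / 2) / 2 with hr
  -- r is the midpoint of d/2 and s, so γ > 0 even when β = 0. In H^s itself the error h^{min(α,β)}
  -- would then not be small and the bootstrap would not close.
  set γ : ℝ := s + β - r with hγ
  have hr1 : (d : ℝ) / 2 < r := by rw [hr]; linarith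
  have hrs : r ≤ s := by rw [hr]; linarith
  have hrγ : r + γ = s + β := by rw [hγ]; ring
  have hβγ : β ≤ γ := by rw [hγ]; linarith
  have hγ0 : 0 < γ := by rw [hγ, hr]; linarith
  obtain ⟨h₀, hh₀, hlow⟩ : ∃ h₀ ∈ Ioc (0 : ℝ) 1, ∀ h ∈ Ioo 0 h₀, ∀ v : ℝ → L2 d,
      IsSolution (P h) (saturatedNonlinearity ε σ (fun ξ => χ (h • ξ))) T u₀ v →
      ∀ t ∈ Icc 0 T, wNorm (weight r) (v t) ≤ M + 1 := by
    obtain ⟨L, hL, hLip⟩ := exists_wNorm_nonlinearity_sub_le (d := d) hr1 hγ0.le hε σ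
      (A := M + 1) (by finiteness)
    obtain ⟨h₀, hh₀, hsmall⟩ := exists_forall_mul_rpow_le (Z := 2 * (ENNReal.ofReal (T * |C₀|) * D +
      ENNReal.ofReal L * ENNReal.ofReal T) * ENNReal.ofReal (Real.exp (2 * L * T)))
      (by finiteness) (lt_min hα hγ0)
    refine ⟨h₀, hh₀, fun h hh v hv => ?_⟩
    have hh1 : h ∈ Ioc (0 : ℝ) 1 := ⟨hh.1, hh.2.le.trans hh₀.2⟩
    have hχδ := one_sub_cutoff_le hχ01 hχone hγ0.le hh.1
    have hhγ : 0 ≤ h ^ γ := Real.rpow_nonneg hh.1.le γ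
    -- B, and below L', depend on h. They enter only as the finite crude bounds of the bootstrap and
    -- affect neither L nor the threshold h₀.
    obtain ⟨B, hB, hvB⟩ := hpers h hh.1
    replace hvB := hvB h hh1 le_rfl v hv
    obtain ⟨hvc, G, hGi, hG, hvd⟩ := hv
    rw [ae_restrict_iff' measurableSet_Icc] at hG
    have hvBr : ∀ t ∈ Icc 0 T, wNorm (weight r) (v t) ≤ B := fun t ht =>
      (wNorm_mono (weight_mono hrs) _).trans (hvB t ht)
    obtain ⟨L', hL', hLip'⟩ := exists_wNorm_nonlinearity_sub_le (d := d) hr1 hγ0.le hε σ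
      (A := M + B) (by finiteness)
    have hyB : ∀ t ∈ Icc 0 T, wNorm (weight r) (u t - v t) ≤ M + B := fun t ht =>
      (wNorm_sub_le (measurable_weight r) _ _).trans
        (add_le_add (hMs r (by linarith) t ht) (hvBr t ht))
    have hy1 := bootstrap_ennreal (y := fun t => wNorm (weight r) (u t - v t))
      (N := fun τ => wNorm (weight r) (F τ - G τ)) (T := T) (L := L) (δ := ENNReal.ofReal (h ^ γ))
      (B := M + B) (K := ENNReal.ofReal L' * (M + B + ENNReal.ofReal (h ^ γ))) hT.le hL
      (by finiteness) (by finiteness) hyB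
      (hdiff r γ hrγ hβγ h hh1 v G hGi hvd)
      (by
        filter_upwards [hF, hG] with τ e1 e2 hτ
        refine (hLip' _ (hχm h) (hχh h) _ hhγ hχδ _ _ _ _ (e1 hτ) (e2 hτ)
          (by rw [hrγ]; exact (hM τ hτ).trans le_self_add)
          ((hvBr τ hτ).trans le_add_self)).trans ?_
        have := hyB τ hτ
        gcongr)
      (by
        filter_upwards [hF, hG] with τ e1 e2 hτ hy
        refine hLip _ (hχm h) (hχh h) _ hhγ hχδ _ _ _ _ (e1 hτ) (e2 hτ)
          (by rw [hrγ]; exact (hM τ hτ).trans le_self_add) ?_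
        -- From v = u - (u - v), the hypothesis ‖u - v‖ ≤ 1 gives ‖v‖ ≤ M + 1, the radius for which
        -- L was chosen.
        have h1 := wNorm_sub_le (measurable_weight r) (u τ) (u τ - v τ)
        rw [sub_sub_cancel] at h1
        exact h1.trans (add_le_add (hMs r (by linarith) τ hτ) hy))
      ((error_le (by positivity) hh1 _ _ _).trans (hsmall h hh))
    intro t ht
    have h1 := wNorm_sub_le (measurable_weight r) (u t) (u t - v t)
    rw [sub_sub_cancel] at h1
    exact h1.trans (add_le_add (hMs r (by linarith) t ht) (hy1 t ht))
  -- a uniform bound in `H^s`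
  obtain ⟨R, hR, hvR⟩ : ∃ R : ENNReal, R ≠ ⊤ ∧ ∀ h ∈ Ioc (0 : ℝ) 1, ∀ v : ℝ → L2 d,
      IsSolution (P h) (saturatedNonlinearity ε σ (fun ξ => χ (h • ξ))) T u₀ v →
      ∀ t ∈ Icc 0 T, wNorm (weight s) (v t) ≤ R := by
    obtain ⟨B, hB, hvB⟩ := hpers h₀ hh₀.1
    obtain ⟨R, hR, hvR⟩ := exists_wNorm_saturated_le_of_low (T := T) hr1 hrs hε σ
      (A := M + 1) (by finiteness) hM0s
    refine ⟨B + R, by finiteness, fun h hh v hv t ht => ?_⟩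
    -- Away from h = 0 persistence is already uniform. Below h₀ it yields only finiteness, and
    -- uniformity comes from the H^r bound.
    rcases le_or_gt h₀ h with hle | hlt
    · exact (hvB h hh hle v hv t ht).trans le_self_add
    · obtain ⟨B', hB', hvB'⟩ := hpers h hh.1
      exact (hvR (P h) _ (hPmeas h hh) (hχm h) (hχh h) v hv ⟨B', hB', hvB' h hh le_rfl v hv⟩
        (hlow h ⟨hh.1, hlt⟩ v hv) t ht).trans le_add_self
  -- the final Grönwall argument
  obtain ⟨L, hL, hLip⟩ := exists_wNorm_nonlinearity_sub_le (d := d) hs hβ hε σ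
    (A := M + R) (by finiteness)
  -- The constant after `error_le`; it depends on M, M₁, R and the data, and not on h or v.
  set Z : ENNReal := 2 * (ENNReal.ofReal (T * |C₀|) * D +
    ENNReal.ofReal L * ENNReal.ofReal T) * ENNReal.ofReal (Real.exp (2 * L * T)) with hZ
  have hZt : Z ≠ ⊤ := by finiteness
  refine ⟨Z.toReal, fun h hh v hv => supSobolevENorm_le fun t ht => ?_⟩
  rw [ENNReal.ofReal_mul ENNReal.toReal_nonneg, ENNReal.ofReal_toReal hZt]
  have hχδ := one_sub_cutoff_le hχ01 hχone hβ hh.1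
  have hvR := hvR h hh v hv
  obtain ⟨hvc, G, hGi, hG, hvd⟩ := hv
  rw [ae_restrict_iff' measurableSet_Icc] at hG
  have hgr := gronwall_ennreal_source (y := fun t => wNorm (weight s) (u t - v t))
    (N := fun τ => wNorm (weight s) (F τ - G τ)) (t₀ := T) (T := T) (L := L)
    (δ := ENNReal.ofReal (h ^ β)) (B := M + R) hL le_rfl (by finiteness)
    (fun t ht => (wNorm_sub_le (measurable_weight s) _ _).trans
      (add_le_add (hMs s (by linarith) t ht) (hvR t ht)))
    (hdiff s β rfl le_rfl h hh v G hGi hvd)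
    (by
      filter_upwards [hF, hG] with τ e1 e2 hτ
      exact hLip _ (hχm h) (hχh h) _ (Real.rpow_nonneg hh.1.le β) hχδ _ _ _ _ (e1 hτ) (e2 hτ)
        ((hM τ hτ).trans le_self_add) ((hvR τ hτ).trans le_add_self)) t ht
  refine (hgr.trans ?_).trans (error_le (by positivity) hh _ _ _)
  have h2 : L * t ≤ L * T := mul_le_mul_of_nonneg_left ht.2 hL
  gcongr ?_ * ENNReal.ofReal (Real.exp ?_)
  · exact le_rfl
  · linarith
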